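/- A \emph{sandpile} $S$ is a finite connected loopless multigraph with a distinguished vertex $s$, the sink; let $V_o$ be the set of the other (ordinary) vertices, and assume that the graph obtained by deleting $s$ is connected. Let $d(v)$ be the number of edges at $v$. A configuration is a map $c\colon V_o\to\mathbb{N}$. An ordinary vertex $v$ with $c(v)\ge d(v)$ may topple: it loses $d(v)$ particles and every ordinary neighbour gains one particle for each edge it shares with $v$; $c$ is stable if no vertex can topple. A configuration is recurrent if it can be obtained from every configuration by adding particles and then performing topplings. The \emph{transience class} $\mathrm{tcl}(S)$ is the maximum number of particles that can be added one by one, starting from the empty configuration and stabilizing after every addition, before a recurrent configuration is reached (it is $0$ if the empty configuration is already recurrent). For $w\in V_o$ let $\pi_w$ be the function on the vertices with $\pi_w(s)=0$, $\pi_w(w)=1$ that is harmonic at all other vertices (edges counted with multiplicity). There is a polynomial-time algorithm that approximates the transience class of sandpiles of bounded degree up to constant factors. Precisely: there are an algorithm (a random access machine program, with logarithmic cost) and a polynomial $T$, and for every $\Delta$ a constant $C\ge 1$ depending only on $\Delta$, such that for every sandpile $S$ as above all of whose ordinary vertices have degree at most $\Delta$, given by its sink and its adjacency matrix with multiplicities,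 the algorithm halts in time at most $T(\text{length of the input})$ and outputs a rational number $A\ge 0$ with $$\tfrac1C\,A\;\le\;\mathrm{tcl}(S)\;\le\;C\,A ,$$ in particular $\mathrm{tcl}(S)$ is finite. Moreover, whenever $\mathrm{tcl}(S)>0$, the output is obtained from the harmonic potentials of all pairs: $$A=\max_{v,w\in V_o}\ \frac{1}{\pi_w(v)}\sum_{u\in V_o}\pi_w(u).$$ -/

import Mathlib

/-! ## Abelian sandpiles -/

/-- A loopless multigraph on `V`: `mult u v` is the number of edges joining `u` and `v`. -/
structure Multigraph (V : Type) where
  mult : V → V → ℕ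
  mult_comm : ∀ u v, mult u v = mult v u
  mult_self : ∀ v, mult v v = 0

/-- The underlying simple graph: two vertices are adjacent if at least one edge joins them. -/
def Multigraph.graph {V : Type} (G : Multigraph V) : SimpleGraph V where
  Adj u v := 0 < G.mult u v
  symm := ⟨fun u v h => by rw [G.mult_comm v u]; exact h⟩
  loopless := ⟨fun v h => by rw [G.mult_self v] at h; exact lt_irrefl 0 h⟩

/-- A sandpile: a connected multigraph with a distinguished sink. -/
structure Sandpile (V : Type) extends Multigraph V where
  sink : V
  connected : toMultigraph.graph.Connected

namespace Sandpile

variable {V : Type}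

/-- The ordinary (non-sink) vertices. -/
abbrev Ordinary (S : Sandpile V) : Type := {v : V // v ≠ S.sink}

/-- A configuration: the number of particles on each ordinary vertex. -/
abbrev Config (S : Sandpile V) : Type := S.Ordinary → ℕ

/-- The graph obtained by deleting the sink is connected. -/
def ConnectedOffSink (S : Sandpile V) : Prop :=
  (S.graph.induce {v | v ≠ S.sink}).Preconnected

variable [Fintype V] [DecidableEq V]

/-- Number of edges at `v` (edges to the sink included). -/
def degree (S : Sandpile V) (v : V) : ℕ := ∑ u, S.mult v u

/-- No ordinary vertex can topple. -/
def Stable (S : Sandpile V) (c : S.Config) : Prop := ∀ v, c v < S.degree v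

/-- The result of toppling `v` once (to be used when `v` is unstable). -/
def topple (S : Sandpile V) (v : S.Ordinary) (c : S.Config) : S.Config :=
  fun u => if u = v then c u - S.degree v else c u + S.mult v u

/-- One legal toppling. -/
def TopplesTo (S : Sandpile V) (c c' : S.Config) : Prop :=
  ∃ v : S.Ordinary, S.degree v ≤ c v ∧ c' = S.topple v c

/-- There is a (possibly empty) toppling sequence from `c` to `c'`. -/
def Relaxes (S : Sandpile V) (c c' : S.Config) : Prop :=
  Relation.ReflTransGen S.TopplesTo c c'

/-- `c'` can be obtained from `c` by adding particles and then toppling. -/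
def Reachable (S : Sandpile V) (c c' : S.Config) : Prop := ∃ d, c ≤ d ∧ S.Relaxes d c'

/-- A configuration is recurrent if it is reachable from every configuration. -/
def Recurrent (S : Sandpile V) (c : S.Config) : Prop := ∀ c', S.Reachable c' c

/-- `S.TransientRun k c`: starting from the empty configuration, `k` particles can be added one
by one, stabilizing after each addition, so that `c` is obtained and no configuration met on the
way (first and last included) is recurrent. -/
inductive TransientRun (S : Sandpile V) : ℕ → S.Config → Prop
  | empty : ¬ S.Recurrent 0 → TransientRun S 0 0
  | add {k : ℕ} {c c' : S.Config} (v : S.Ordinary) :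
      TransientRun S k c → S.Relaxes (c + Pi.single v 1) c' → S.Stable c' →
      ¬ S.Recurrent c' → TransientRun S (k + 1) c'

/-- The transience class: the maximum number of particles that can be added before a recurrent
configuration is reached (`⊤` if there is no bound, `0` if the empty configuration is already
recurrent). -/
noncomputable def tcl (S : Sandpile V) : ℕ∞ :=
  ⨆ k ∈ {k : ℕ | ∃ c, S.TransientRun k c}, (k : ℕ∞)

/-- `π` is the potential with poles `w` (value `1`) and the sink (value `0`): it is harmonic at
every other vertex, edges being counted with multiplicity. -/
def IsPotential (S : Sandpile V) (w : S.Ordinary) (π : V → ℝ) : Prop :=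
  π S.sink = 0 ∧ π w = 1 ∧
    ∀ v : V, v ≠ S.sink → v ≠ w → (∑ u, (S.mult v u : ℝ) * π u) / (S.degree v : ℝ) = π v

/-- The values `(1 / π_w(v)) * ∑ u, π_w(u)`, where `(v, w)` runs over all pairs of ordinary
vertices and `π_w` is the potential with poles `w` and the sink. -/
def potentialEstimates (S : Sandpile V) : Set ℝ :=
  {r | ∃ (v w : S.Ordinary) (π : V → ℝ), S.IsPotential w π ∧
    r = 1 / π v * ∑ u : S.Ordinary, π u}

end Sandpile

/-! ## Random access machine programs with logarithmic cost

A machine has integer registers `reg x` and memory banks whose cells `mem a i` are addressed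
indirectly. A program mentions finitely many registers and banks. Every value that is computed,
read or used as an address is charged its bit length. -/

namespace RAM

/-- Machine states. -/
structure State where
  reg : ℕ → ℤ
  mem : ℕ → ℕ → ℤ

/-- Write `z` into register `x`. -/
def State.setReg (s : State) (x : ℕ) (z : ℤ) : State :=
  ⟨Function.update s.reg x z, s.mem⟩

/-- Write `z` into cell `i` of bank `a`. -/
def State.setMem (s : State) (a i : ℕ) (z : ℤ) : State :=
  ⟨s.reg, Function.update s.mem a (Function.update (s.mem a) i z)⟩

/-- Arithmetic expressions. -/
inductive Expr
  | const (z : ℤ)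
  | reg (x : ℕ)
  | load (a : ℕ) (i : Expr)
  | add (e f : Expr)
  | sub (e f : Expr)
  | mul (e f : Expr)
  | div (e f : Expr)

/-- The value of an expression. Division is rounded integer division, with value `0` if the
divisor is `0`; a negative address is read as address `0`. -/
def Expr.eval (s : State) : Expr → ℤ
  | .const z => z
  | .reg x => s.reg x
  | .load a i => s.mem a (i.eval s).toNat
  | .add e f => e.eval s + f.eval s
  | .sub e f => e.eval s - f.eval s
  | .mul e f => e.eval s * f.eval s
  | .div e f => e.eval s / f.eval s

/-- Cost of handling an integer: one plus the number of its binary digits. -/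
def wordCost (z : ℤ) : ℕ := 1 + z.natAbs.size

/-- The cost of evaluating an expression: the sum of the word costs of the values of all its
subexpressions, so that operands, addresses and results are all charged. -/
def Expr.cost (s : State) : Expr → ℕ
  | .const z => wordCost z
  | .reg x => wordCost (s.reg x)
  | .load a i => i.cost s + wordCost (s.mem a (i.eval s).toNat)
  | .add e f => e.cost s + f.cost s + wordCost (e.eval s + f.eval s)
  | .sub e f => e.cost s + f.cost s + wordCost (e.eval s - f.eval s)
  | .mul e f => e.cost s + f.cost s + wordCost (e.eval s * f.eval s)
  | .div e f => e.cost s + f.cost s + wordCost (e.eval s / f.eval s)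

/-- Programs. The tests of conditionals and loops are `0 < e`. -/
inductive Program
  | skip
  | assign (x : ℕ) (e : Expr)
  | store (a : ℕ) (i e : Expr)
  | seq (P Q : Program)
  | ite (e : Expr) (P Q : Program)
  | loop (e : Expr) (P : Program)

/-- `Exec P s s' t`: started in state `s`, the program `P` halts in state `s'` after running for
time `t`. -/
inductive Exec : Program → State → State → ℕ → Prop
  | skip (s : State) : Exec .skip s s 1
  | assign (s : State) (x : ℕ) (e : Expr) :
      Exec (.assign x e) s (s.setReg x (e.eval s)) (1 + e.cost s)
  | store (s : State) (a : ℕ) (i e : Expr) :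
      Exec (.store a i e) s
        (s.setMem a (i.eval s).toNat (e.eval s))
        (1 + i.cost s + e.cost s)
  | seq {P Q : Program} {s s' s'' : State} {t t' : ℕ} :
      Exec P s s' t → Exec Q s' s'' t' → Exec (.seq P Q) s s'' (1 + t + t')
  | ite_pos {e : Expr} {P Q : Program} {s s' : State} {t : ℕ} :
      0 < e.eval s → Exec P s s' t → Exec (.ite e P Q) s s' (1 + e.cost s + t)
  | ite_neg {e : Expr} {P Q : Program} {s s' : State} {t : ℕ} :
      ¬ 0 < e.eval s → Exec Q s s' t → Exec (.ite e P Q) s s' (1 + e.cost s + t)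
  | loop_done {e : Expr} {P : Program} {s : State} :
      ¬ 0 < e.eval s → Exec (.loop e P) s s (1 + e.cost s)
  | loop_step {e : Expr} {P : Program} {s s' s'' : State} {t t' : ℕ} :
      0 < e.eval s → Exec P s s' t → Exec (.loop e P) s' s'' t' →
      Exec (.loop e P) s s'' (1 + e.cost s + t + t')

end RAM

namespace Sandpile

/-- The initial machine state for a sandpile with vertices `0, …, n - 1`: register `0` holds `n`,
register `1` holds the sink, bank `0` holds the adjacency matrix (with multiplicities) row by
row, and everything else is `0`. -/
def input {n : ℕ} (S : Sandpile (Fin n)) : RAM.State where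
  reg x := if x = 0 then (n : ℤ) else if x = 1 then (S.sink : ℤ) else 0
  mem a k :=
    if h : a = 0 ∧ k < n * n then
      (S.mult (Fin.divNat ⟨k, h.2⟩) (Fin.modNat ⟨k, h.2⟩) : ℤ)
    else 0

/-- The length of the input in binary. -/
def inputSize {n : ℕ} (S : Sandpile (Fin n)) : ℕ :=
  RAM.wordCost n + RAM.wordCost (S.sink : ℕ) + ∑ i, ∑ j, RAM.wordCost (S.mult i j)

end Sandpile

/-! Everything is measured with the Green functions `S.green w`, written g_w here: g_w vanishes at
the sink, and its Laplacian at ordinary vertices is 1 at `w` and 0 elsewhere. Since π_w = g_w /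
g_w(w), the estimate is A = max over v, w of (∑ g_w) / g_w(v). Weigh a configuration `c` by ∑ g_w(u)
c(u). Toppling `y` subtracts the Laplacian of g_w at `y`: the weight drops by 1 if y = w and is
conserved otherwise.

Upper bound. A configuration is recurrent exactly when it has no forbidden subconfiguration
(`NoForbidden.recurrent`, `Recurrent.noForbidden`), and a set all of whose vertices have toppled is
never forbidden. Hence after a transient run of `k` particles some `v` has never toppled, and the
weight by g_v has only grown: k · min g_v ≤ ∑ g_v(u) c(u) ≤ Δ ∑ g_v, so k ≤ Δ A
(`TransientRun.le_mul`).

Lower bound. Drop all particles at `v` and weigh by g_w: after `k` particles the weight is at most k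
g_w(v). In a recurrent configuration every empty vertex has an occupied neighbour, so Harnack's
inequality makes the weight at least ∑ g_w / (1 + Δ²) (`NoForbidden.sum_green_le`). Therefore
transient runs of length about A / (1 + Δ²) exist (`exists_transientRun`). Rounding is harmless as
soon as one particle is never enough, which holds with at least two edges between ordinary vertices;
with at most one such edge the transience class is 0.

Computation. The g_w are entries of the adjugate of the reduced Laplacian divided by its
determinant, and the determinant cancels in the ratios. The adjugate is found by fraction-free
exchange steps. No pivot search is needed, because any matrix mixing Laplacian rows with identity
rows is nonsingular (`det_ne_zero_of_rows`), and all intermediate numbers have polynomial length,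
because they are built from minors (`Matrix.natAbs_partialAdjugate_le`). -/

/-! ### Program logic and running time for the machine -/

namespace RAM

/-! ### Expressions in states with bounded entries -/

/-- All registers and memory cells have absolute value less than `2 ^ b`. -/
def Bounded (b : ℕ) (s : State) : Prop :=
  (∀ x, (s.reg x).natAbs < 2 ^ b) ∧ ∀ a i, (s.mem a i).natAbs < 2 ^ b

/-- A syntactic measure of expressions. -/
def Expr.weight : Expr → ℕ
  | .const z => 1 + z.natAbs
  | .reg _ => 1
  | .load _ i => 1 + i.weight
  | .add e f => 1 + e.weight + f.weight
  | .sub e f => 1 + e.weight + f.weight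
  | .mul e f => 1 + e.weight + f.weight
  | .div e f => 1 + e.weight + f.weight

theorem two_pow_add_two_pow_le {x y z : ℕ} (h : x + y + 1 ≤ z) : 2 ^ x + 2 ^ y ≤ 2 ^ z := by
  have h1 : 2 ^ x ≤ 2 ^ (x + y) := Nat.pow_le_pow_right (by norm_num) (by omega)
  have h2 : 2 ^ y ≤ 2 ^ (x + y) := Nat.pow_le_pow_right (by norm_num) (by omega)
  have h3 : 2 ^ (x + y + 1) ≤ 2 ^ z := Nat.pow_le_pow_right (by norm_num) h
  rw [pow_succ] at h3
  omega

/-- Bit lengths at most add under each operation, up to one carry bit; `b ≥ 1` lets the extra 1 in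
the weight of a node pay for the carry. A loaded value is below `2 ^ b` whatever its address. -/
theorem Expr.natAbs_eval_lt {b : ℕ} (hb : 1 ≤ b) {s : State} (hs : Bounded b s) (e : Expr) :
    (e.eval s).natAbs < 2 ^ (b * e.weight) := by
  have key : ∀ w v, b * w + b * v + 1 ≤ b * (1 + w + v) := fun w v => by
    rw [mul_add, mul_add]; omega
  induction e with
  | const z =>
    simp only [Expr.eval, Expr.weight]
    calc z.natAbs < 2 ^ z.natAbs := Nat.lt_two_pow_self
      _ ≤ _ := Nat.pow_le_pow_right (by norm_num) (by nlinarith [Nat.zero_le z.natAbs])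
  | reg x => simpa [Expr.eval, Expr.weight] using hs.1 x
  | load a i ih =>
    simp only [Expr.eval, Expr.weight]
    exact (hs.2 _ _).trans_le (Nat.pow_le_pow_right (by norm_num) (by nlinarith))
  | add e f he hf =>
    simp only [Expr.eval, Expr.weight]
    have := two_pow_add_two_pow_le (key e.weight f.weight)
    have := Int.natAbs_add_le (e.eval s) (f.eval s)
    omega
  | sub e f he hf =>
    simp only [Expr.eval, Expr.weight]
    have := two_pow_add_two_pow_le (key e.weight f.weight)
    have := Int.natAbs_sub_le (e.eval s) (f.eval s)
    omega
  | mul e f he hf =>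
    simp only [Expr.eval, Expr.weight, Int.natAbs_mul]
    calc _ < 2 ^ (b * e.weight) * 2 ^ (b * f.weight) := Nat.mul_lt_mul'' he hf
      _ = 2 ^ (b * e.weight + b * f.weight) := (pow_add _ _ _).symm
      _ ≤ _ := Nat.pow_le_pow_right (by norm_num) (by have := key e.weight f.weight; omega)
  | div e f he hf =>
    simp only [Expr.eval, Expr.weight]
    have h : (e.eval s / f.eval s).natAbs ≤ (e.eval s).natAbs := by
      have := Int.abs_ediv_le_abs (e.eval s) (f.eval s)
      rw [Int.abs_eq_natAbs, Int.abs_eq_natAbs] at this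
      exact_mod_cast this
    refine (h.trans_lt he).trans_le (Nat.pow_le_pow_right (by norm_num) ?_)
    have := key e.weight f.weight
    omega

theorem wordCost_le {z : ℤ} {b : ℕ} (h : z.natAbs < 2 ^ b) : wordCost z ≤ 1 + b :=
  Nat.add_le_add_left (Nat.size_le.2 h) 1

/-- There are at most `e.weight` subexpressions, and the value of each has at most `b * e.weight`
bits. -/
theorem Expr.cost_le {b : ℕ} (hb : 1 ≤ b) {s : State} (hs : Bounded b s) (e : Expr) :
    e.cost s ≤ e.weight * (1 + b * e.weight) := by
  have hw : ∀ e : Expr, wordCost (e.eval s) ≤ 1 + b * e.weight := fun e =>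
    wordCost_le (e.natAbs_eval_lt hb hs)
  have key : ∀ x y v w c : ℕ, x ≤ v * (1 + b * v) → y ≤ w * (1 + b * w) →
      c ≤ 1 + b * (1 + v + w) → x + y + c ≤ (1 + v + w) * (1 + b * (1 + v + w)) := by
    intro x y v w c hx hy hc
    have h1 : v * (1 + b * v) ≤ v * (1 + b * (1 + v + w)) := by gcongr; omega
    have h2 : w * (1 + b * w) ≤ w * (1 + b * (1 + v + w)) := by gcongr; omega
    nlinarith
  induction e with
  | const z =>
    have := hw (.const z)
    simp only [Expr.eval, Expr.cost, Expr.weight] at this ⊢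
    nlinarith [Nat.zero_le z.natAbs]
  | reg x => simpa [Expr.eval, Expr.cost, Expr.weight] using hw (.reg x)
  | load a i ih =>
    have h := hw (.load a i)
    have := key _ 0 _ 0 _ ih (by simp) (by simpa [Expr.eval, Expr.weight] using h)
    simpa [Expr.eval, Expr.cost, Expr.weight] using this
  | add e f he hf => exact key _ _ _ _ _ he hf (hw (.add e f))
  | sub e f he hf => exact key _ _ _ _ _ he hf (hw (.sub e f))
  | mul e f he hf => exact key _ _ _ _ _ he hf (hw (.mul e f))
  | div e f he hf => exact key _ _ _ _ _ he hf (hw (.div e f))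

/-- A bound for the cost of one elementary step whose expressions have weight at most `30`. -/
def stepCost (b : ℕ) : ℕ := 1 + 60 * (1 + b * 30)

theorem Expr.cost_le_of_weight {b : ℕ} (hb : 1 ≤ b) {s : State} (hs : Bounded b s) {e : Expr}
    (he : e.weight ≤ 30) : e.cost s ≤ 30 * (1 + b * 30) :=
  (e.cost_le hb hs).trans (by gcongr)

theorem Bounded.setReg {b : ℕ} {s : State} (hs : Bounded b s) (x : ℕ) {z : ℤ}
    (hz : z.natAbs < 2 ^ b) : Bounded b (s.setReg x z) := by
  refine ⟨fun y => ?_, hs.2⟩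
  by_cases h : y = x
  · subst h; simpa [State.setReg] using hz
  · simpa [State.setReg, h] using hs.1 y

theorem Bounded.setMem {b : ℕ} {s : State} (hs : Bounded b s) (a i : ℕ) {z : ℤ}
    (hz : z.natAbs < 2 ^ b) : Bounded b (s.setMem a i z) := by
  refine ⟨hs.1, fun c j => ?_⟩
  by_cases h : c = a
  · subst h
    by_cases h' : j = i
    · subst h'; simpa [State.setMem] using hz
    · simpa [State.setMem, h'] using hs.2 c j
  · simpa [State.setMem, h] using hs.2 c j

@[simp] theorem State.reg_setReg (s : State) (x y : ℕ) (z : ℤ) :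
    (s.setReg x z).reg y = if y = x then z else s.reg y := by
  simp [State.setReg, Function.update_apply]

@[simp] theorem State.reg_setMem (s : State) (a i : ℕ) (z : ℤ) : (s.setMem a i z).reg = s.reg := rfl

@[simp] theorem State.mem_setMem (s : State) (a i c j : ℕ) (z : ℤ) :
    (s.setMem a i z).mem c j = if c = a ∧ j = i then z else s.mem c j := by
  by_cases h : c = a
  · subst h; simp [State.setMem, Function.update_apply]
  · simp [State.setMem, h]

/-! ### Registers and banks a program may change -/

/-- The registers a program may change. -/
def Program.regs : Program → List ℕ
  | .skip => []
  | .assign x _ => [x]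
  | .store _ _ _ => []
  | .seq P Q => P.regs ++ Q.regs
  | .ite _ P Q => P.regs ++ Q.regs
  | .loop _ P => P.regs

/-- The banks a program may change. -/
def Program.banks : Program → List ℕ
  | .skip => []
  | .assign _ _ => []
  | .store a _ _ => [a]
  | .seq P Q => P.banks ++ Q.banks
  | .ite _ P Q => P.banks ++ Q.banks
  | .loop _ P => P.banks

/-- The states agree outside the registers `R` and the banks `B`. -/
def Agree (R B : List ℕ) (s s' : State) : Prop :=
  (∀ x, x ∉ R → s'.reg x = s.reg x) ∧ ∀ a, a ∉ B → s'.mem a = s.mem a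

theorem Agree.refl (R B : List ℕ) (s : State) : Agree R B s s := ⟨fun _ _ => rfl, fun _ _ => rfl⟩

theorem Agree.trans {R B : List ℕ} {s s' s'' : State} (h : Agree R B s s')
    (h' : Agree R B s' s'') : Agree R B s s'' :=
  ⟨fun x hx => (h'.1 x hx).trans (h.1 x hx), fun a ha => (h'.2 a ha).trans (h.2 a ha)⟩

theorem Agree.mono {R B R' B' : List ℕ} {s s' : State} (h : Agree R B s s') (hR : R ⊆ R')
    (hB : B ⊆ B') : Agree R' B' s s' :=
  ⟨fun x hx => h.1 x fun hx' => hx (hR hx'), fun a ha => h.2 a fun ha' => ha (hB ha')⟩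

theorem Agree.setReg {R B : List ℕ} {s s' : State} (h : Agree R B s s') {x : ℕ} (hx : x ∈ R)
    (z : ℤ) : Agree R B s (s'.setReg x z) := by
  refine ⟨fun y hy => ?_, h.2⟩
  have : y ≠ x := fun e => hy (e ▸ hx)
  simpa [this] using h.1 y hy

/-- The frame rule: what a program does not mention as a target survives its execution. The side
conditions are decidable on the program text. -/
theorem Exec.agree {P : Program} {s s' : State} {t : ℕ} (h : Exec P s s' t) :
    Agree P.regs P.banks s s' := by
  induction h with
  | skip s => exact Agree.refl _ _ _
  | assign s x e => exact (Agree.refl _ _ _).setReg (by simp [Program.regs]) _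
  | store s a i e =>
    refine ⟨fun _ _ => rfl, fun c hc => ?_⟩
    have : c ≠ a := by simpa [Program.banks] using hc
    simp [State.setMem, this]
  | seq _ _ h h' =>
    exact (h.mono (by simp [Program.regs]) (by simp [Program.banks])).trans
      (h'.mono (by simp [Program.regs]) (by simp [Program.banks]))
  | ite_pos _ _ h => exact h.mono (by simp [Program.regs]) (by simp [Program.banks])
  | ite_neg _ _ h => exact h.mono (by simp [Program.regs]) (by simp [Program.banks])
  | loop_done _ => exact Agree.refl _ _ _
  | loop_step _ _ _ h h' => exact Agree.trans h h'

/-! ### Program logic -/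

/-- Started in `s`, assumed to be bounded, the program `P` halts in a bounded state satisfying
`Q` after at most `k` steps, each of cost at most `stepCost b`. -/
def Runs (b : ℕ) (P : Program) (s : State) (k : ℕ) (Q : State → Prop) : Prop :=
  Bounded b s → ∃ s' t, Exec P s s' t ∧ t ≤ k * stepCost b ∧ Bounded b s' ∧ Q s'

theorem one_le_stepCost (b : ℕ) : 1 ≤ stepCost b := Nat.le_add_right _ _

/-- Consequence and frame rule in one: the weakened postcondition may use that untouched registers
and banks are unchanged, so specifications need only list what was computed. -/
theorem Runs.mono {b : ℕ} {P : Program} {s : State} {k k' : ℕ} {Q Q' : State → Prop}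
    (h : Runs b P s k Q) (hk : k ≤ k') (hQ : ∀ s', Agree P.regs P.banks s s' → Q s' → Q' s') :
    Runs b P s k' Q' := fun hs => by
  obtain ⟨s', t, he, ht, hb, hq⟩ := h hs
  exact ⟨s', t, he, ht.trans (Nat.mul_le_mul_right _ hk), hb, hQ s' he.agree hq⟩

theorem Runs.skip {b K : ℕ} {s : State} {Q : State → Prop} (hQ : Q s)
    (hK : 1 ≤ K := by omega) : Runs b .skip s K Q := fun hs =>
  ⟨s, 1, .skip s, by nlinarith [one_le_stepCost b], hs, hQ⟩

/-- Only stored values have to fit into `b` bits; intermediate values are covered by the weight of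
the expression. Boundedness of the state may be assumed for this, which makes copying a register
free. -/
theorem Runs.assign {b K : ℕ} (hb : 1 ≤ b) {s : State} {x : ℕ} {e : Expr} {Q : State → Prop}
    (hw : e.weight ≤ 30) (hz : Bounded b s → (e.eval s).natAbs < 2 ^ b)
    (hQ : Q (s.setReg x (e.eval s))) (hK : 1 ≤ K := by omega) :
    Runs b (.assign x e) s K Q := fun hs => by
  refine ⟨_, _, .assign s x e, le_trans ?_ (Nat.le_mul_of_pos_left _ hK), hs.setReg x (hz hs), hQ⟩
  have := Expr.cost_le_of_weight hb hs hw
  unfold stepCost; omega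

theorem Runs.store {b K : ℕ} (hb : 1 ≤ b) {s : State} {a : ℕ} {i e : Expr} {Q : State → Prop}
    (hi : i.weight ≤ 30) (hw : e.weight ≤ 30) (hz : Bounded b s → (e.eval s).natAbs < 2 ^ b)
    (hQ : Q (s.setMem a (i.eval s).toNat (e.eval s))) (hK : 1 ≤ K := by omega) :
    Runs b (.store a i e) s K Q := fun hs => by
  refine ⟨_, _, .store s a i e, le_trans ?_ (Nat.le_mul_of_pos_left _ hK), hs.setMem a _ (hz hs), hQ⟩
  have := Expr.cost_le_of_weight hb hs hw
  have := Expr.cost_le_of_weight hb hs hi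
  unfold stepCost; omega

theorem Runs.seq {b K : ℕ} {P P' : Program} {s : State} (k k' : ℕ) {Q : State → Prop}
    (h : Runs b P s k fun s' => Runs b P' s' k' Q) (hK : 1 + k + k' ≤ K := by omega) :
    Runs b (.seq P P') s K Q := fun hs => by
  obtain ⟨s', t, he, ht, hb, hq⟩ := h hs
  obtain ⟨s'', t', he', ht', hb', hq'⟩ := hq hb
  refine ⟨s'', _, .seq he he', le_trans ?_ (Nat.mul_le_mul_right _ hK), hb', hq'⟩
  have := one_le_stepCost b
  rw [add_mul, add_mul]; omega

theorem Runs.ite {b K : ℕ} (hb : 1 ≤ b) {e : Expr} {P P' : Program} {s : State} (k : ℕ)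
    {Q : State → Prop} (hw : e.weight ≤ 30) (h : 0 < e.eval s → Runs b P s k Q)
    (h' : ¬ 0 < e.eval s → Runs b P' s k Q) (hK : 1 + k ≤ K := by omega) :
    Runs b (.ite e P P') s K Q := fun hs => by
  have hc := Expr.cost_le_of_weight hb hs hw
  have hc' : 1 + e.cost s ≤ stepCost b := by unfold stepCost; omega
  by_cases he : 0 < e.eval s
  · obtain ⟨s', t, hx, ht, hb, hq⟩ := h he hs
    refine ⟨s', _, .ite_pos he hx, le_trans ?_ (Nat.mul_le_mul_right _ hK), hb, hq⟩
    rw [add_mul]; omega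
  · obtain ⟨s', t, hx, ht, hb, hq⟩ := h' he hs
    refine ⟨s', _, .ite_neg he hx, le_trans ?_ (Nat.mul_le_mul_right _ hK), hb, hq⟩
    rw [add_mul]; omega

/-- Run `P` with register `x` counting from `0` up to the value of `e`, exclusively. -/
def Program.forLoop (x : ℕ) (e : Expr) (P : Program) : Program :=
  .seq (.assign x (.const 0))
    (.loop (.sub e (.reg x)) (.seq P (.assign x (.add (.reg x) (.const 1)))))

/-- The bound `e` must keep its value as long as only the counter and the targets of the body
change, and the invariant must not depend on the counter. A round costs the body plus a test, a
sequencing step and an increment, whence `k + 3`. -/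
theorem Runs.forLoop {b : ℕ} (hb : 1 ≤ b) {x : ℕ} {e : Expr} {P : Program} {s : State} (k N : ℕ)
    {K : ℕ} {Q : State → Prop} (I : ℕ → State → Prop) (hN : N < 2 ^ b) (hw : e.weight ≤ 20)
    (hx : x ∉ P.regs) (heval : ∀ s', Agree (x :: P.regs) P.banks s s' → e.eval s' = N)
    (hI : ∀ m s z, I m s → I m (s.setReg x z)) (h0 : I 0 s)
    (hstep : ∀ m < N, ∀ s', Agree (x :: P.regs) P.banks s s' → s'.reg x = m → I m s' →
      Runs b P s' k (I (m + 1)))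
    (hQ : ∀ s', Agree (x :: P.regs) P.banks s s' → I N s' → Q s')
    (hK : N * (k + 3) + 3 ≤ K := by omega) : Runs b (.forLoop x e P) s K Q := by
  -- Induction on the number `r` of rounds still to come.
  have aux : ∀ r m s', m + r = N → Agree (x :: P.regs) P.banks s s' → s'.reg x = m → I m s' →
      Runs b (.loop (.sub e (.reg x)) (.seq P (.assign x (.add (.reg x) (.const 1))))) s'
        (r * (k + 3) + 1) Q := by
    intro r
    induction r with
    | zero =>
      intro m s' hm hA hr hi hs
      have hc := Expr.cost_le_of_weight (e := .sub e (.reg x)) hb hs (by simp [Expr.weight]; omega)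
      refine ⟨s', _, .loop_done ?_, ?_, hs, hQ s' hA ?_⟩
      · simp only [Expr.eval, heval s' hA, hr]; omega
      · unfold stepCost; omega
      · obtain rfl : m = N := by omega
        exact hi
    | succ r ih =>
      intro m s' hm hA hr hi hs
      have hc := Expr.cost_le_of_weight (e := .sub e (.reg x)) hb hs (by simp [Expr.weight]; omega)
      obtain ⟨s₁, t₁, he₁, ht₁, hb₁, hi₁⟩ := hstep m (by omega) s' hA hr hi hs
      have hA₁ := hA.trans (he₁.agree.mono (List.subset_cons_self _ _) (List.Subset.refl _))
      have hr₁ : s₁.reg x = m := by rw [he₁.agree.1 x hx, hr]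
      have hv : (Expr.add (.reg x) (.const 1)).eval s₁ = ((m + 1 : ℕ) : ℤ) := by
        simp [Expr.eval, hr₁]
      have hlt : (((m + 1 : ℕ) : ℤ)).natAbs < 2 ^ b := by rw [Int.natAbs_natCast]; omega
      obtain ⟨s₂, t₂, he₂, ht₂, hb₂, rfl⟩ :=
        Runs.assign (x := x) (e := .add (.reg x) (.const 1)) (Q := (· = s₁.setReg x ((m + 1 : ℕ) : ℤ)))
          hb (by simp [Expr.weight]) (fun _ => by rwa [hv]) (by rw [hv]) le_rfl hb₁
      obtain ⟨s₃, t₃, he₃, ht₃, hb₃, hq₃⟩ := ih (m + 1) _ (by omega)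
        (hA₁.setReg (by simp) _) (by simp) (hI _ _ _ hi₁) hb₂
      refine ⟨s₃, _, .loop_step ?_ (.seq he₁ he₂) he₃, ?_, hb₃, hq₃⟩
      · simp only [Expr.eval, heval s' hA, hr]; omega
      · have h1 := one_le_stepCost b
        have h2 : 1 + (Expr.sub e (.reg x)).cost s' ≤ stepCost b := by unfold stepCost; omega
        calc _ ≤ stepCost b + (stepCost b + k * stepCost b + 1 * stepCost b) +
              (r * (k + 3) + 1) * stepCost b := by omega
          _ = _ := by ring
  exact Runs.seq 1 (N * (k + 3) + 1) (Runs.assign hb (by simp [Expr.weight])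
    (fun _ => by simp [Expr.eval]) (aux N 0 _ (by omega) ((Agree.refl _ _ _).setReg (by simp) _)
      (by simp [Expr.eval]) (hI _ _ _ h0)))

end RAM

/-! ### Division-exact computation of the adjugate -/

namespace Matrix

/-! ### Fraction-free exchange steps -/

section Exchange

variable {ι : Type*} [Fintype ι] [DecidableEq ι]

theorem det_updateRow_eq_mul_adjugate (M : Matrix ι ι ℤ) (k : ι) (r : ι → ℤ) :
    (M.updateRow k r).det = ∑ j, r j * M.adjugate j k := by
  rw [← cramer_transpose_apply, cramer_eq_adjugate_mulVec, ← adjugate_transpose]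
  simp [mulVec, dotProduct, mul_comm]

/-- The fraction-free exchange step with pivot `k`, multiplied by `d`. -/
def exchange (a : Matrix ι ι ℤ) (d : ℤ) (k : ι) : Matrix ι ι ℤ := fun i j =>
  if i = k then if j = k then d * d else -(d * a k j)
  else if j = k then d * a i k else a k k * a i j - a i k * a k j

/-- The matrix N M⁻¹ carries Mx to Nx. Exchanging the `k`-th input coordinate with the `k`-th output
coordinate swaps the rows `k` of `M` and `N`, and acts on the entries as a principal pivot. Clearing
denominators by the two determinants gives integer matrices, and shows that the pivot formula is
divisible by the previous determinant. -/
theorem exchange_eq {M N : Matrix ι ι ℤ} {k : ι} (hM : M k = Pi.single k 1)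
    (hdet : (M.updateRow k (N k)).det ≠ 0) :
    exchange (N * M.adjugate) M.det k =
      M.det • (N.updateRow k (Pi.single k 1) * (M.updateRow k (N k)).adjugate) := by
  set a := N * M.adjugate with ha
  set M' := M.updateRow k (N k) with hM'
  set N' := N.updateRow k (Pi.single k 1) with hN'
  set d := M.det
  have hp : M'.det = a k k := by
    rw [hM', det_updateRow_eq_mul_adjugate, ha, mul_apply]
  have haM : a * M = d • N := by rw [ha, Matrix.mul_assoc, adjugate_mul, Matrix.mul_smul,
      Matrix.mul_one]
  -- Row `k` of `M` is a unit vector, so its contribution to `a * M = d • N` can be moved to the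
  -- other side explicitly.
  have hrow : ∀ i l, ∑ j ∈ Finset.univ.erase k, a i j * M j l =
      d * N i l - a i k * (Pi.single k 1 : ι → ℤ) l := by
    intro i l
    have h := congrFun (congrFun haM i) l
    rw [mul_apply, ← Finset.add_sum_erase _ _ (Finset.mem_univ k), hM] at h
    simp only [smul_apply, smul_eq_mul] at h
    linarith
  -- It suffices to check the claim after multiplication by `M'`, whose determinant is nonzero.
  have hkey : exchange a d k * M' = (d * M'.det) • N' := by
    ext i l
    rw [mul_apply, ← Finset.add_sum_erase _ _ (Finset.mem_univ k)]
    have h1 : M' k l = N k l := by simp [hM']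
    have h2 : ∀ j ∈ Finset.univ.erase k, exchange a d k i j * M' j l =
        if i = k then -d * (a k j * M j l)
        else a k k * (a i j * M j l) - a i k * (a k j * M j l) := by
      intro j hj
      have hj' : j ≠ k := Finset.ne_of_mem_erase hj
      have : M' j l = M j l := by simp [hM', updateRow_ne hj']
      rw [this]
      simp only [exchange, hj', if_false]
      split_ifs <;> ring
    rw [Finset.sum_congr rfl h2, h1, hp]
    by_cases hi : i = k
    · subst hi
      simp only [if_true, ← Finset.mul_sum, hrow]
      simp [exchange, hN']
      ring
    · simp only [hi, if_false, Finset.sum_sub_distrib, ← Finset.mul_sum, hrow]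
      simp [exchange, hN', hi]
      ring
  have h := congrArg (· * M'.adjugate) hkey
  simp only [Matrix.mul_assoc, mul_adjugate, smul_mul] at h
  have h' : M'.det • exchange a d k = M'.det • (d • (N' * M'.adjugate)) := by
    rw [smul_smul, mul_comm M'.det d, ← h, Matrix.mul_smul, Matrix.mul_one]
  ext i j
  have := congrFun (congrFun h' i) j
  simp only [smul_apply, smul_eq_mul] at this ⊢
  exact mul_left_cancel₀ hdet this

end Exchange

section Partial

variable {n : ℕ}

/-- The first `k` rows are those of `A`, the others those of `B`. -/
def mixRows (k : ℕ) (A B : Matrix (Fin n) (Fin n) ℤ) : Matrix (Fin n) (Fin n) ℤ :=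
  fun i => if i.val < k then A i else B i

theorem mixRows_succ {k : ℕ} (hk : k < n) (A B : Matrix (Fin n) (Fin n) ℤ) :
    mixRows (k + 1) A B = (mixRows k A B).updateRow ⟨k, hk⟩ (A ⟨k, hk⟩) := by
  ext i j
  by_cases h : i = ⟨k, hk⟩
  · subst h; simp [mixRows]
  · have : i.val ≠ k := fun e => h (Fin.ext e)
    rw [updateRow_ne h]
    simp only [mixRows]
    simp only [Nat.lt_succ_iff_lt_or_eq, this, or_false]

/-- The matrix obtained from `A` by `k` fraction-free exchange steps. -/
def partialAdjugate (A : Matrix (Fin n) (Fin n) ℤ) (k : ℕ) : Matrix (Fin n) (Fin n) ℤ :=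
  mixRows k 1 A * (mixRows k A 1).adjugate

theorem partialAdjugate_zero (A : Matrix (Fin n) (Fin n) ℤ) : partialAdjugate A 0 = A := by
  have h : ∀ A B : Matrix (Fin n) (Fin n) ℤ, mixRows 0 A B = B := fun A B => by
    ext; simp [mixRows]
  simp [partialAdjugate, h]

theorem mixRows_self (A B : Matrix (Fin n) (Fin n) ℤ) : mixRows n A B = A := by
  ext; simp [mixRows]

theorem partialAdjugate_self (A : Matrix (Fin n) (Fin n) ℤ) :
    partialAdjugate A n = A.adjugate := by
  simp [partialAdjugate, mixRows_self]

theorem det_mixRows_zero (A : Matrix (Fin n) (Fin n) ℤ) : (mixRows 0 A 1).det = 1 := by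
  have : mixRows 0 A 1 = 1 := by ext; simp [mixRows]
  simp [this]

/-- The pivot of a step is the next leading principal minor, hence also the divisor of the following
step. -/
theorem det_mixRows_succ (A : Matrix (Fin n) (Fin n) ℤ) {k : ℕ} (hk : k < n) :
    (mixRows (k + 1) A 1).det = partialAdjugate A k ⟨k, hk⟩ ⟨k, hk⟩ := by
  rw [mixRows_succ hk, det_updateRow_eq_mul_adjugate, partialAdjugate, mul_apply]
  simp [mixRows]

theorem exchange_partialAdjugate (A : Matrix (Fin n) (Fin n) ℤ) {k : ℕ} (hk : k < n)
    (hdet : (mixRows (k + 1) A 1).det ≠ 0) :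
    exchange (partialAdjugate A k) (mixRows k A 1).det ⟨k, hk⟩ =
      (mixRows k A 1).det • partialAdjugate A (k + 1) := by
  have hN : mixRows k 1 A ⟨k, hk⟩ = A ⟨k, hk⟩ := by simp [mixRows]
  have h1 : (1 : Matrix (Fin n) (Fin n) ℤ) ⟨k, hk⟩ = Pi.single ⟨k, hk⟩ 1 := by
    ext j; simp [one_apply, Pi.single_apply, eq_comm]
  have hM : mixRows k A 1 ⟨k, hk⟩ = Pi.single ⟨k, hk⟩ 1 := by simp [mixRows, h1]
  have h := exchange_eq (M := mixRows k A 1) (N := mixRows k 1 A) hM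
    (by rwa [hN, ← mixRows_succ hk])
  rw [hN, ← mixRows_succ hk, ← h1, ← mixRows_succ hk] at h
  exact h

theorem natAbs_det_le {A : Matrix (Fin n) (Fin n) ℤ} {X : ℕ} (h : ∀ i j, (A i j).natAbs ≤ X) :
    A.det.natAbs ≤ n ^ n * X ^ n := by
  have := Matrix.det_le (A := A) (abv := (AbsoluteValue.abs : AbsoluteValue ℤ ℤ)) (x := (X : ℤ))
    (fun i j => by
      change |A i j| ≤ X
      rw [Int.abs_eq_natAbs]
      exact_mod_cast h i j)
  change |A.det| ≤ _ at this
  rw [Int.abs_eq_natAbs, Fintype.card_fin, nsmul_eq_mul] at this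
  have h2 : A.det.natAbs ≤ n.factorial * X ^ n := by exact_mod_cast this
  exact h2.trans (Nat.mul_le_mul_right _ n.factorial_le_pow)

theorem natAbs_adjugate_le {A : Matrix (Fin n) (Fin n) ℤ} {X : ℕ} (hX : 1 ≤ X)
    (h : ∀ i j, (A i j).natAbs ≤ X) (i j : Fin n) :
    (A.adjugate i j).natAbs ≤ n ^ n * X ^ n := by
  rw [adjugate_apply]
  refine natAbs_det_le fun u v => ?_
  by_cases hu : u = j
  · subst hu
    rw [updateRow_self, Pi.single_apply]
    split_ifs <;> simp [hX]
  · rw [updateRow_ne hu]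
    exact h u v

theorem natAbs_mixRows_le {A B : Matrix (Fin n) (Fin n) ℤ} {X k : ℕ}
    (hA : ∀ i j, (A i j).natAbs ≤ X) (hB : ∀ i j, (B i j).natAbs ≤ X) (i j : Fin n) :
    (mixRows k A B i j).natAbs ≤ X := by
  unfold mixRows
  split_ifs
  exacts [hA i j, hB i j]

/-- Entries at every stage are sums of `n` products of an entry with a minor, so their length does
not compound from step to step. -/
theorem natAbs_partialAdjugate_le {A : Matrix (Fin n) (Fin n) ℤ} {X : ℕ} (hX : 1 ≤ X)
    (h : ∀ i j, (A i j).natAbs ≤ X) (k : ℕ) (i j : Fin n) :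
    (partialAdjugate A k i j).natAbs ≤ n * (X * (n ^ n * X ^ n)) := by
  have h1 : ∀ i j : Fin n, ((1 : Matrix (Fin n) (Fin n) ℤ) i j).natAbs ≤ X := by
    intro i j; rw [one_apply]; split_ifs <;> simp [hX]
  rw [partialAdjugate, mul_apply]
  refine (Int.natAbs_sum_le _ _).trans ?_
  refine (Finset.sum_le_card_nsmul _ _ (X * (n ^ n * X ^ n)) fun l _ => ?_).trans (by simp)
  rw [Int.natAbs_mul]
  exact Nat.mul_le_mul (natAbs_mixRows_le h1 h _ _)
    (natAbs_adjugate_le hX (natAbs_mixRows_le h h1) _ _)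

end Partial

end Matrix

set_option linter.unusedSectionVars false

/-! ### Potential theory on the graph -/

namespace Sandpile

variable {V : Type} [Fintype V] [DecidableEq V] (S : Sandpile V)

/-! ### The minimum principle and Green functions -/

/-- The Laplacian of a function at a vertex. -/
def laplace (f : V → ℝ) (v : V) : ℝ := S.degree v * f v - ∑ u, (S.mult v u : ℝ) * f u

variable {S}

theorem laplace_eq_sum (f : V → ℝ) (v : V) :
    S.laplace f v = ∑ u, (S.mult v u : ℝ) * (f v - f u) := by
  simp only [laplace, degree, mul_sub, Finset.sum_sub_distrib, ← Finset.sum_mul]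
  push_cast
  rfl

theorem laplace_neg (f : V → ℝ) (v : V) : S.laplace (fun u => -f u) v = -S.laplace f v := by
  simp [laplace, Finset.sum_neg_distrib]; ring

theorem laplace_sub (f g : V → ℝ) (v : V) :
    S.laplace (fun u => f u - g u) v = S.laplace f v - S.laplace g v := by
  simp [laplace, mul_sub, Finset.sum_sub_distrib]; ring

/-- A function that is nonnegative at the sink and superharmonic wherever it is negative is
nonnegative. -/
theorem nonneg_of_laplace_nonneg {f : V → ℝ} (hs : 0 ≤ f S.sink)
    (hf : ∀ v, v ≠ S.sink → f v < 0 → 0 ≤ S.laplace f v) (v : V) : 0 ≤ f v := by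
  obtain ⟨x, -, hx⟩ := Finset.exists_min_image Finset.univ f ⟨v, Finset.mem_univ v⟩
  by_contra! hv
  have hneg : f x < 0 := (hx v (Finset.mem_univ v)).trans_lt hv
  -- At a negative minimum the Laplacian is a sum of nonpositive terms, yet nonnegative; so all
  -- neighbours attain the minimum too, and the value spreads to the sink.
  have hstep : ∀ y z, f y = f x → S.graph.Adj y z → f z = f x := by
    intro y z hy hyz
    have hys : y ≠ S.sink := by rintro rfl; linarith
    have hl := hf y hys (by linarith)
    rw [laplace_eq_sum] at hl
    have hterm : ∀ u ∈ Finset.univ, (S.mult y u : ℝ) * (f y - f u) ≤ 0 := fun u hu =>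
      mul_nonpos_of_nonneg_of_nonpos (Nat.cast_nonneg _) (by have := hx u hu; linarith)
    have h0 := (Finset.sum_eq_zero_iff_of_nonpos hterm).1
      (le_antisymm (Finset.sum_nonpos hterm) hl) z (Finset.mem_univ z)
    have hpos : (0 : ℝ) < S.mult y z := Nat.cast_pos.2 hyz
    have := (mul_eq_zero.1 h0).resolve_left hpos.ne'
    linarith
  have hall : ∀ y z, S.graph.Walk y z → f y = f x → f z = f x := by
    intro y z p
    induction p with
    | nil => exact id
    | cons h _ ih => exact fun hy => ih (hstep _ _ hy h)
  obtain ⟨p⟩ := S.connected.preconnected x S.sink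
  have := hall _ _ p rfl
  linarith

/-- The Green function with pole `w`. -/
structure IsGreen (S : Sandpile V) (w : V) (g : V → ℝ) : Prop where
  sink : g S.sink = 0
  laplace : ∀ v, v ≠ S.sink → S.laplace g v = if v = w then 1 else 0

theorem IsGreen.nonneg {w : V} {g : V → ℝ} (hg : S.IsGreen w g) (v : V) : 0 ≤ g v :=
  nonneg_of_laplace_nonneg hg.sink.ge (fun v hv _ => by
    rw [hg.laplace v hv]; split_ifs <;> norm_num) v

/-- At a zero of `g` the Laplacian is minus a sum of nonnegative terms, so zeros spread to all
neighbours. As the graph without the sink is connected, they would reach `w`, where the Laplacian is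
1. -/
theorem IsGreen.pos (hS : S.ConnectedOffSink) {w : S.Ordinary} {g : V → ℝ} (hg : S.IsGreen w g)
    (v : S.Ordinary) : 0 < g v := by
  have hstep : ∀ x y : S.Ordinary, g x = 0 → S.graph.Adj x y → g y = 0 := by
    intro x y hx hxy
    have hl := hg.laplace x x.2
    have hterm : ∀ u ∈ Finset.univ, 0 ≤ (S.mult x u : ℝ) * g u := fun u _ =>
      mul_nonneg (Nat.cast_nonneg _) (hg.nonneg u)
    have h1 : ∑ u, (S.mult x u : ℝ) * g u ≤ 0 := by
      rw [Sandpile.laplace, hx] at hl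
      split_ifs at hl <;> linarith
    have h0 := (Finset.sum_eq_zero_iff_of_nonneg hterm).1
      (le_antisymm h1 (Finset.sum_nonneg hterm)) y (Finset.mem_univ _)
    have hpos : (0 : ℝ) < S.mult x y := Nat.cast_pos.2 hxy
    exact (mul_eq_zero.1 h0).resolve_left hpos.ne'
  have hw : g w ≠ 0 := fun h => by
    have hl := hg.laplace w w.2
    rw [Sandpile.laplace, h, if_pos rfl] at hl
    have := Finset.sum_nonneg fun u (_ : u ∈ Finset.univ) =>
      mul_nonneg (Nat.cast_nonneg (α := ℝ) (S.mult w u)) (hg.nonneg u)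
    linarith
  refine lt_of_le_of_ne (hg.nonneg v) fun h => hw ?_
  have hall : ∀ y z, (S.graph.induce {v | v ≠ S.sink}).Walk y z → g y = 0 → g z = 0 := by
    intro y z p
    induction p with
    | nil => exact id
    | cons h _ ih => exact fun hy => ih (hstep _ _ hy h)
  obtain ⟨p⟩ := hS v w
  exact hall _ _ p h.symm

theorem degree_pos {v : V} (hv : v ≠ S.sink) : 0 < S.degree v := by
  obtain ⟨p⟩ := S.connected.preconnected v S.sink
  cases p with
  | nil => exact absurd rfl hv
  | cons h _ =>
    exact lt_of_lt_of_le h (Finset.single_le_sum (f := fun u => S.mult v u)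
      (fun _ _ => Nat.zero_le _) (Finset.mem_univ _))

theorem isPotential_iff {w : S.Ordinary} {f : V → ℝ} :
    S.IsPotential w f ↔ f S.sink = 0 ∧ f w = 1 ∧
      ∀ v, v ≠ S.sink → v ≠ w → S.laplace f v = 0 := by
  refine and_congr Iff.rfl (and_congr Iff.rfl (forall_congr' fun v => ?_))
  refine forall_congr' fun hv => forall_congr' fun _ => ?_
  have : (S.degree v : ℝ) ≠ 0 := Nat.cast_ne_zero.2 (degree_pos hv).ne'
  rw [div_eq_iff this, Sandpile.laplace, sub_eq_zero, mul_comm (f v), eq_comm]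

/-- Uniqueness is the minimum principle for the difference of two potentials: it is harmonic
wherever it is negative, since it vanishes at `w`. -/
theorem IsGreen.isPotential_iff (hS : S.ConnectedOffSink) {w : S.Ordinary} {g : V → ℝ}
    (hg : S.IsGreen w g) {f : V → ℝ} : S.IsPotential w f ↔ f = fun v => g v / g w := by
  have hw := hg.pos hS w
  have hpot : S.IsPotential w fun v => g v / g w := by
    refine Sandpile.isPotential_iff.2 ⟨by simp [hg.sink], div_self hw.ne', fun v hv hvw => ?_⟩
    have h := hg.laplace v hv
    rw [if_neg hvw, Sandpile.laplace] at h
    simp only [Sandpile.laplace, div_eq_mul_inv, ← mul_assoc, ← Finset.sum_mul, ← sub_mul, h,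
      zero_mul]
  refine ⟨fun hf => ?_, fun h => h ▸ hpot⟩
  have key : ∀ f₁ f₂ : V → ℝ, S.IsPotential w f₁ → S.IsPotential w f₂ → ∀ v, f₂ v ≤ f₁ v := by
    intro f₁ f₂ h₁ h₂ v
    rw [Sandpile.isPotential_iff] at h₁ h₂
    refine sub_nonneg.1 (nonneg_of_laplace_nonneg (S := S) (f := fun v => f₁ v - f₂ v)
      (by simp [h₁.1, h₂.1]) (fun v hv hneg => ?_) v)
    have hvw : v ≠ w := by rintro rfl; simp [h₁.2.1, h₂.2.1] at hneg
    rw [laplace_sub, h₁.2.2 v hv hvw, h₂.2.2 v hv hvw, sub_zero]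
  exact funext fun v => le_antisymm (key _ _ hpot hf v) (key _ _ hf hpot v)

variable (S) in
/-- The Laplacian matrix, with the row and the column of the sink replaced by those of the
identity. -/
def laplacian : Matrix V V ℤ := fun i j =>
  if i = S.sink ∨ j = S.sink then if i = j then 1 else 0
  else if i = j then S.degree i else -S.mult i j

theorem laplacian_transpose : S.laplacian.transpose = S.laplacian := by
  ext i j
  simp only [Matrix.transpose_apply, laplacian, or_comm, eq_comm (a := j), S.mult_comm j i]
  split_ifs with h1 h2 h3 <;> simp_all

theorem sum_laplacian_sink (f : V → ℝ) : ∑ u, (S.laplacian S.sink u : ℝ) * f u = f S.sink := by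
  rw [Finset.sum_eq_single S.sink] <;> simp +contextual [laplacian, eq_comm]

theorem sum_laplacian {f : V → ℝ} (hf : f S.sink = 0) {v : V} (hv : v ≠ S.sink) :
    ∑ u, (S.laplacian v u : ℝ) * f u = S.laplace f v := by
  have h : ∀ u, (S.laplacian v u : ℝ) * f u =
      (if u = v then (S.degree v : ℝ) * f v else 0) - S.mult v u * f u := by
    intro u
    by_cases hu : u = S.sink
    · subst hu; simp [hf, Ne.symm hv]
    · by_cases huv : u = v
      · subst huv; simp [laplacian, hu, S.mult_self]
      · simp [laplacian, hu, hv, huv, Ne.symm huv]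
  simp [h, Finset.sum_sub_distrib, laplace]

/-- A function that vanishes off a set on which it is harmonic vanishes. -/
theorem eq_zero_of_laplace {f : V → ℝ} (hs : f S.sink = 0)
    (hf : ∀ v, v ≠ S.sink → f v ≠ 0 → S.laplace f v = 0) : f = 0 := by
  refine funext fun v => le_antisymm ?_ ?_
  · have := nonneg_of_laplace_nonneg (S := S) (f := fun u => -f u) (by simp [hs])
      (fun v hv h => by rw [laplace_neg, hf v hv (by intro h0; simp [h0] at h), neg_zero]) v
    simpa using this
  · exact nonneg_of_laplace_nonneg hs.ge (fun v hv h => (hf v hv h.ne).ge) v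

/-- A kernel vector vanishes where the row is a unit vector and is harmonic where it is a Laplacian
row, so the minimum principle kills it. Besides the Laplacian itself this covers all the pivots of
the elimination. -/
theorem det_ne_zero_of_rows {M : Matrix V V ℤ}
    (hM : ∀ i, M i = S.laplacian i ∨ M i = Pi.single i 1) : M.det ≠ 0 := by
  intro h
  have h' : (M.map (Int.cast : ℤ → ℝ)).det = 0 := by
    have := (Int.castRingHom ℝ).map_det M
    rw [h] at this
    simpa using this.symm
  obtain ⟨x, hx, hMx⟩ := Matrix.exists_mulVec_eq_zero_iff.2 h'
  have hrow : ∀ i, ∑ j, (M i j : ℝ) * x j = 0 := fun i => congrFun hMx i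
  have hs : x S.sink = 0 := by
    have := hrow S.sink
    rcases hM S.sink with h | h
    · rwa [h, sum_laplacian_sink] at this
    · simpa [h, Pi.single_apply] using this
  refine hx (eq_zero_of_laplace hs fun v hv hxv => ?_)
  have := hrow v
  rcases hM v with h | h
  · rwa [h, sum_laplacian hs hv] at this
  · exact absurd (by simpa [h, Pi.single_apply] using this) hxv

theorem det_laplacian_ne_zero : S.laplacian.det ≠ 0 := det_ne_zero_of_rows fun _ => Or.inl rfl

theorem sum_laplacian_adjugate (v w : V) :
    ∑ u, S.laplacian v u * S.laplacian.adjugate u w = if v = w then S.laplacian.det else 0 := by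
  have := congrFun (congrFun (Matrix.mul_adjugate S.laplacian) v) w
  rw [Matrix.mul_apply] at this
  simpa [Matrix.one_apply] using this

theorem adjugate_sink {w : V} (hw : w ≠ S.sink) : S.laplacian.adjugate S.sink w = 0 := by
  have h := sum_laplacian_adjugate (S := S) S.sink w
  rw [if_neg hw.symm] at h
  have h' := sum_laplacian_sink (S := S) fun u => (S.laplacian.adjugate u w : ℝ)
  have h'' : ∑ u, (S.laplacian S.sink u : ℝ) * (S.laplacian.adjugate u w : ℝ) = 0 := by
    exact_mod_cast h
  rw [h''] at h'
  exact_mod_cast h'.symm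

variable (S) in
/-- The Green functions, as entries of the inverse of the Laplacian matrix. -/
noncomputable def green (w v : V) : ℝ := S.laplacian.adjugate v w / S.laplacian.det

theorem isGreen_green {w : V} (hw : w ≠ S.sink) : S.IsGreen w (S.green w) := by
  have hs : S.green w S.sink = 0 := by simp [green, adjugate_sink hw]
  have hd : (S.laplacian.det : ℝ) ≠ 0 := Int.cast_ne_zero.2 det_laplacian_ne_zero
  refine ⟨hs, fun v hv => ?_⟩
  rw [← sum_laplacian hs hv]
  have h := sum_laplacian_adjugate (S := S) v w
  have h' : ∑ u, (S.laplacian v u : ℝ) * (S.laplacian.adjugate u w : ℝ) =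
      if v = w then (S.laplacian.det : ℝ) else 0 := by exact_mod_cast h
  simp only [green, mul_div_assoc', ← Finset.sum_div, h']
  split_ifs
  · exact div_self hd
  · exact zero_div _

theorem green_comm (v w : V) : S.green v w = S.green w v := by
  have h := congrFun (congrFun (Matrix.adjugate_transpose S.laplacian) v) w
  rw [laplacian_transpose, Matrix.transpose_apply] at h
  rw [green, green, h]

/-- The normalization `g w` of the potential cancels in the quotient. -/
theorem potentialEstimates_eq (hS : S.ConnectedOffSink) :
    S.potentialEstimates =
      {r | ∃ v w : S.Ordinary, r = (∑ u : S.Ordinary, S.green w u) / S.green w v} := by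
  ext r
  constructor
  · rintro ⟨v, w, f, hf, rfl⟩
    have hg := isGreen_green (S := S) w.2
    refine ⟨v, w, ?_⟩
    have hw := (hg.pos hS w).ne'
    have hv := (hg.pos hS v).ne'
    rw [(hg.isPotential_iff hS).1 hf, ← Finset.sum_div]
    field_simp
  · rintro ⟨v, w, rfl⟩
    have hg := isGreen_green (S := S) w.2
    refine ⟨v, w, _, (hg.isPotential_iff hS).2 rfl, ?_⟩
    have hw := (hg.pos hS w).ne'
    have hv := (hg.pos hS v).ne'
    rw [← Finset.sum_div]
    field_simp

end Sandpile

/-! ### Recurrent configurations and the upper bound -/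

namespace Sandpile

variable {V : Type} [Fintype V] [DecidableEq V] {S : Sandpile V}

/-! ### Recurrence and forbidden subconfigurations -/

variable (S) in
/-- Every nonempty set `F` of ordinary vertices has a vertex with at least as many particles as
neighbours in `F`. -/
def NoForbidden (c : S.Config) : Prop :=
  ∀ F : Finset S.Ordinary, F.Nonempty → ∃ v ∈ F, ∑ u ∈ F, S.mult v u ≤ c v

/-- If the toppled vertex `y` lies in `F`, use the good vertex of `F` without `y`: its new neighbour
`y` has just sent it one particle per edge. -/
theorem NoForbidden.of_topplesTo {c c' : S.Config} (hc : S.NoForbidden c)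
    (h : S.TopplesTo c c') : S.NoForbidden c' := by
  obtain ⟨y, hy, rfl⟩ := h
  intro F hF
  by_cases hyF : y ∈ F
  · rcases (F.erase y).eq_empty_or_nonempty with h0 | hne
    · have : F = {y} := by
        rw [← Finset.insert_erase hyF, h0]; simp
      exact ⟨y, hyF, by simp [this, S.mult_self]⟩
    · obtain ⟨v, hv, hle⟩ := hc _ hne
      have hvy := Finset.ne_of_mem_erase hv
      refine ⟨v, Finset.mem_of_mem_erase hv, ?_⟩
      rw [← Finset.add_sum_erase _ _ hyF, topple, if_neg hvy, S.mult_comm v y]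
      omega
  · obtain ⟨v, hv, hle⟩ := hc F hF
    have hvy : v ≠ y := fun h => hyF (h ▸ hv)
    exact ⟨v, hv, by rw [topple, if_neg hvy]; omega⟩

theorem NoForbidden.of_relaxes {c c' : S.Config} (hc : S.NoForbidden c)
    (h : S.Relaxes c c') : S.NoForbidden c' := by
  induction h with
  | refl => exact hc
  | tail _ h ih => exact ih.of_topplesTo h

theorem sum_ordinary {M : Type*} [AddCommMonoid M] (f : V → M) :
    ∑ u, f u = f S.sink + ∑ u : S.Ordinary, f u :=
  Fintype.sum_eq_add_sum_subtype_ne f S.sink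

/-- Having `d(v)` particles everywhere excludes forbidden sets, and recurrent configurations are
reached from there. -/
theorem Recurrent.noForbidden {c : S.Config} (hc : S.Recurrent c) : S.NoForbidden c := by
  obtain ⟨d, hd, hr⟩ := hc fun v => S.degree v
  refine NoForbidden.of_relaxes (fun F hF => ?_) hr
  obtain ⟨v, hv⟩ := hF
  refine ⟨v, hv, le_trans ?_ (hd v)⟩
  change _ ≤ ∑ u, S.mult v u
  rw [sum_ordinary (S := S)]
  exact (Finset.sum_le_sum_of_subset (Finset.subset_univ F)).trans (Nat.le_add_left _ _)

/-- If `e` is `c` plus the Laplacian of `r`, then `e` relaxes to `c` by toppling each `v` exactly `r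
v` times. A legal order exists: always topple where the remaining count is maximal. -/
theorem NoForbidden.relaxes {c : S.Config} (hc : S.NoForbidden c) (r : V → ℕ)
    (hr : r S.sink = 0) (e : S.Config)
    (he : ∀ v : S.Ordinary, e v + ∑ u, S.mult v u * r u = c v + S.degree v * r v) :
    S.Relaxes e c := by
  induction hk : ∑ u, r u generalizing r e with
  | zero =>
    have h0 : ∀ u, r u = 0 := fun u => by
      have := Finset.sum_eq_zero_iff.1 hk u (Finset.mem_univ u)
      exact this
    have : e = c := funext fun v => by simpa [h0] using he v
    exact this ▸ Relation.ReflTransGen.refl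
  | succ k ih =>
    obtain ⟨x, -, hx⟩ := Finset.exists_max_image Finset.univ r ⟨S.sink, Finset.mem_univ _⟩
    have hpos : 0 < r x := by
      by_contra h
      have : ∑ u, r u = 0 := Finset.sum_eq_zero fun u hu => by have := hx u hu; omega
      omega
    have hxs : x ≠ S.sink := by rintro rfl; omega
    -- On the set `F` where `r` is maximal, a vertex `v` with enough particles in `c` can topple in
    -- `e`: it has at least one particle per edge into `F` from `c`, and one per edge leaving `F`
    -- because `r` drops there.
    obtain ⟨v, hv, hle⟩ := hc (Finset.univ.filter fun u : S.Ordinary => r u = r x)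
      ⟨⟨x, hxs⟩, by simp⟩
    have hvx : r v = r x := (Finset.mem_filter.1 hv).2
    have hleg : S.degree v ≤ e v := by
      have h1 : ∑ u, (if r u = r x then S.mult v u else 0) ≤ c v := by
        rw [sum_ordinary (S := S), if_neg (by omega), zero_add, ← Finset.sum_filter]
        exact hle
      have h2 : ∑ u, (S.mult v u * r u + S.mult v u) ≤
          ∑ u, (S.mult v u * r x + if r u = r x then S.mult v u else 0) := by
        refine Finset.sum_le_sum fun u hu => ?_
        have := hx u hu
        split_ifs with h
        · rw [h]
        · have : r u + 1 ≤ r x := by omega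
          nlinarith [Nat.zero_le (S.mult v u)]
      rw [Finset.sum_add_distrib, Finset.sum_add_distrib, ← Finset.sum_mul] at h2
      have h3 := he v
      rw [hvx] at h3
      simp only [degree] at h3 ⊢
      omega
    have hupd : ∀ f : V → ℕ, ∑ u, f u * Function.update r v (r v - 1) u + f v =
        ∑ u, f u * r u := by
      intro f
      rw [← Finset.add_sum_erase _ _ (Finset.mem_univ (v : V)),
        ← Finset.add_sum_erase _ (fun u => f u * r u) (Finset.mem_univ (v : V))]
      rw [Finset.sum_congr rfl fun u hu => by
        rw [Function.update_of_ne (Finset.ne_of_mem_erase hu)]]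
      rw [Function.update_self]
      obtain ⟨y, hy⟩ : ∃ y, r v = y + 1 := ⟨r v - 1, by omega⟩
      rw [hy]; simp only [Nat.add_sub_cancel]; ring
    refine Relation.ReflTransGen.head ⟨v, hleg, rfl⟩
      (ih (Function.update r v (r v - 1)) ?_ _ (fun u => ?_) ?_)
    · rw [Function.update_of_ne v.2.symm, hr]
    · have h1 := hupd fun w => S.mult u w
      have h2 := he u
      by_cases huv : u = v
      · subst huv
        rw [topple, if_pos rfl, Function.update_self]
        rw [S.mult_self] at h1
        obtain ⟨y, hy⟩ : ∃ y, r u = y + 1 := ⟨r u - 1, by omega⟩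
        rw [hy] at h1 h2 ⊢
        simp only [Nat.add_sub_cancel] at h1 ⊢
        rw [mul_add] at h2
        omega
      · rw [topple, if_neg huv, Function.update_of_ne (fun h => huv (Subtype.ext h)),
          S.mult_comm v u]
        omega
    · have := hupd fun _ => 1
      simp only [one_mul] at this
      omega

theorem laplace_mul (a : ℝ) (f : V → ℝ) (v : V) :
    S.laplace (fun u => a * f u) v = a * S.laplace f v := by
  simp only [laplace, mul_sub, Finset.mul_sum]
  congr 1
  · ring
  · exact Finset.sum_congr rfl fun _ _ => by ring

theorem laplace_sum {ι : Type*} (s : Finset ι) (f : ι → V → ℝ) (v : V) :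
    S.laplace (fun u => ∑ i ∈ s, f i u) v = ∑ i ∈ s, S.laplace (f i) v := by
  simp only [laplace, Finset.mul_sum, Finset.sum_sub_distrib]
  rw [Finset.sum_comm]

/-- Multiply the sum of all Green functions by the absolute value of the determinant to make it
integral; its Laplacian is then that absolute value. -/
theorem exists_nat_laplace_pos (S : Sandpile V) :
    ∃ f : V → ℕ, f S.sink = 0 ∧ ∀ v, v ≠ S.sink → 1 ≤ S.laplace (fun u => f u) v := by
  refine ⟨fun v => ∑ w : S.Ordinary, (S.laplacian.adjugate v w).natAbs,
    Finset.sum_eq_zero fun w _ => by rw [adjugate_sink w.2]; rfl, fun v hv => ?_⟩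
  have hd : (S.laplacian.det : ℝ) ≠ 0 := Int.cast_ne_zero.2 det_laplacian_ne_zero
  have h : (fun u => ((∑ w : S.Ordinary, (S.laplacian.adjugate u w).natAbs : ℕ) : ℝ)) =
      fun u => |(S.laplacian.det : ℝ)| * ∑ w : S.Ordinary, S.green w u := by
    funext u
    rw [Finset.mul_sum, Nat.cast_sum]
    refine Finset.sum_congr rfl fun w _ => ?_
    rw [← abs_of_nonneg ((isGreen_green (S := S) w.2).nonneg u), ← abs_mul, green,
      mul_div_cancel₀ _ hd, Nat.cast_natAbs, Int.cast_abs]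
  rw [h, laplace_mul, laplace_sum, Finset.sum_congr rfl fun w _ =>
    (isGreen_green (S := S) w.2).laplace v hv]
  rw [Finset.sum_eq_single (⟨v, hv⟩ : S.Ordinary) (fun w _ hw => if_neg fun h => hw (Subtype.ext h.symm))
    (by simp), if_pos rfl, mul_one, ← Int.cast_abs]
  exact_mod_cast Int.one_le_abs det_laplacian_ne_zero

/-- Add to `c` a large multiple of a Laplacian that is at least 1 everywhere. The result dominates
`c'` and still relaxes to `c`. -/
theorem NoForbidden.recurrent {c : S.Config} (hc : S.NoForbidden c) : S.Recurrent c := by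
  intro c'
  obtain ⟨f, hf0, hf⟩ := exists_nat_laplace_pos S
  have hf' : ∀ v : S.Ordinary, 1 + ∑ u, S.mult v u * f u ≤ S.degree v * f v := fun v => by
    have := hf v v.2
    rw [laplace] at this
    have h2 : (1 : ℝ) + ∑ u, (S.mult v u : ℝ) * f u ≤ S.degree v * f v := by linarith
    exact_mod_cast h2
  have hsum : ∀ v : S.Ordinary, ∑ u, S.mult v u * ((∑ w, c' w) * f u) =
      (∑ w, c' w) * ∑ u, S.mult v u * f u := fun v => by
    rw [Finset.mul_sum]; exact Finset.sum_congr rfl fun _ _ => by ring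
  have hmul : ∀ v : S.Ordinary, (∑ w, c' w) * 1 + (∑ w, c' w) * ∑ u, S.mult v u * f u ≤
      (∑ w, c' w) * (S.degree v * f v) := fun v => by
    rw [← mul_add]; exact Nat.mul_le_mul_left _ (hf' v)
  refine ⟨fun v => c v + ((∑ w, c' w) * (S.degree v * f v) -
    (∑ w, c' w) * ∑ u, S.mult v u * f u), fun v => ?_,
    hc.relaxes (fun u => (∑ w, c' w) * f u) (by simp [hf0]) _ fun v => ?_⟩
  · have h1 : c' v ≤ ∑ w, c' w :=
      Finset.single_le_sum (fun _ _ => Nat.zero_le _) (Finset.mem_univ v)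
    have := hmul v
    simp only
    omega
  · rw [hsum, mul_left_comm (S.degree v)]
    have := hmul v
    omega

/-! ### Weights of configurations -/

/-- Summation by parts, with no boundary term because `h` vanishes at the sink. -/
theorem sum_mul_topple {h : V → ℝ} (hs : h S.sink = 0) {v : S.Ordinary} {c : S.Config}
    (hv : S.degree v ≤ c v) :
    ∑ u : S.Ordinary, h u * S.topple v c u = ∑ u : S.Ordinary, h u * c u - S.laplace h v := by
  have h1 : ∀ u : S.Ordinary, h u * (S.topple v c u : ℝ) =
      h u * c u + S.mult v u * h u - if u = v then S.degree v * h v else 0 := by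
    intro u
    by_cases huv : u = v
    · subst huv
      rw [topple, if_pos rfl, if_pos rfl, S.mult_self, Nat.cast_sub hv]
      push_cast; ring
    · rw [topple, if_neg huv, if_neg huv]
      push_cast; ring
  simp only [h1, Finset.sum_sub_distrib, Finset.sum_add_distrib, laplace,
    sum_ordinary (S := S) fun u => (S.mult v u : ℝ) * h u, hs]
  simp
  ring

theorem sum_mul_add_single (h : V → ℝ) (c : S.Config) (w : S.Ordinary) :
    ∑ u : S.Ordinary, h u * ((c + Pi.single w 1 : S.Config) u : ℝ) =
      ∑ u : S.Ordinary, h u * c u + h w := by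
  have h2 : ∀ u : S.Ordinary, h u * ((c + Pi.single w 1 : S.Config) u : ℝ) =
      h u * c u + if u = w then h w else 0 := by
    intro u
    by_cases huw : u = w
    · subst huw; simp; ring
    · simp [huw]
  simp only [h2, Finset.sum_add_distrib]
  simp

theorem Relaxes.sum_mul_le {h : V → ℝ} (hs : h S.sink = 0)
    (hl : ∀ v, v ≠ S.sink → 0 ≤ S.laplace h v) {c c' : S.Config} (hr : S.Relaxes c c') :
    ∑ u : S.Ordinary, h u * c' u ≤ ∑ u : S.Ordinary, h u * c u := by
  induction hr with
  | refl => exact le_rfl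
  | tail _ ht ih =>
    obtain ⟨v, hv, rfl⟩ := ht
    rw [sum_mul_topple hs hv]
    linarith [hl v v.2]

theorem Relaxes.sum_le {c c' : S.Config} (hr : S.Relaxes c c') : ∑ u, c' u ≤ ∑ u, c u := by
  have := hr.sum_mul_le (h := fun u => if u = S.sink then 0 else 1) (by simp) fun v hv => by
    rw [laplace_eq_sum]
    refine Finset.sum_nonneg fun u _ => mul_nonneg (Nat.cast_nonneg _) ?_
    rw [if_neg hv]; split_ifs <;> norm_num
  have h0 : ∀ u : S.Ordinary, (if (u : V) = S.sink then (0 : ℝ) else 1) = 1 := fun u => if_neg u.2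
  simp only [h0, one_mul] at this
  exact_mod_cast this

/-- The weight by a natural-valued function with positive Laplacian strictly decreases at every
toppling. -/
theorem exists_relaxes_stable (c : S.Config) : ∃ c', S.Relaxes c c' ∧ S.Stable c' := by
  obtain ⟨f, hf0, hf⟩ := exists_nat_laplace_pos S
  induction hk : ∑ u : S.Ordinary, f u * c u using Nat.strong_induction_on generalizing c with
  | _ k ih =>
    by_cases hst : S.Stable c
    · exact ⟨c, Relation.ReflTransGen.refl, hst⟩
    · simp only [Stable, not_forall, not_lt] at hst
      obtain ⟨v, hv⟩ := hst
      have h := sum_mul_topple (h := fun u => (f u : ℝ)) (by simp [hf0]) hv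
      have h1 := hf v v.2
      have h2 : ∑ u : S.Ordinary, (f u : ℝ) * S.topple v c u <
          ∑ u : S.Ordinary, (f u : ℝ) * c u := by linarith
      have h3 : ∑ u : S.Ordinary, f u * S.topple v c u < k := by
        rw [← hk]; exact_mod_cast h2
      obtain ⟨c', hr, hs⟩ := ih _ h3 _ rfl
      exact ⟨c', Relation.ReflTransGen.head ⟨v, hv, rfl⟩ hr, hs⟩

/-! ### The upper bound -/

variable (S) in
/-- After the addition of `k` particles, `T` being the set of the vertices that have toppled. -/
structure Tracks (k : ℕ) (T : Set S.Ordinary) (c : S.Config) : Prop where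
  forbidden : ∀ F : Finset S.Ordinary, F.Nonempty →
    (∃ v ∈ F, v ∉ T) ∨ ∃ v ∈ F, ∑ u ∈ F, S.mult v u ≤ c v
  weight : ∀ v, v ∉ T → ∀ m : ℝ, (∀ w : S.Ordinary, m ≤ S.green v w) →
    k * m ≤ ∑ u : S.Ordinary, S.green v u * c u

theorem Tracks.zero : S.Tracks 0 ∅ 0 where
  forbidden _ hF := Or.inl ⟨hF.choose, hF.choose_spec, Set.notMem_empty _⟩
  weight := by simp

theorem Tracks.add {k : ℕ} {T : Set S.Ordinary} {c : S.Config} (h : S.Tracks k T c)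
    (w : S.Ordinary) : S.Tracks (k + 1) T (c + Pi.single w 1) where
  forbidden F hF := (h.forbidden F hF).imp_right fun ⟨v, hv, hle⟩ =>
    ⟨v, hv, hle.trans (Nat.le_add_right _ _)⟩
  weight v hv m hm := by
    have h1 := h.weight v hv m hm
    rw [sum_mul_add_single]
    push_cast
    linarith [hm w]

/-- The first property persists as for `NoForbidden`, with `y` now excused from being untoppled. The
weight by the Green function of a vertex other than `y` is conserved. -/
theorem Tracks.topple {k : ℕ} {T : Set S.Ordinary} {c : S.Config} (h : S.Tracks k T c)
    {y : S.Ordinary} (hy : S.degree y ≤ c y) : S.Tracks k (insert y T) (S.topple y c) where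
  forbidden F hF := by
    by_cases hyF : y ∈ F
    · rcases (F.erase y).eq_empty_or_nonempty with h0 | hne
      · have : F = {y} := by
          rw [← Finset.insert_erase hyF, h0]; simp
        exact Or.inr ⟨y, hyF, by simp [this, S.mult_self]⟩
      · rcases h.forbidden _ hne with ⟨v, hv, hvT⟩ | ⟨v, hv, hle⟩
        · exact Or.inl ⟨v, Finset.mem_of_mem_erase hv,
            by simp [Finset.ne_of_mem_erase hv, hvT]⟩
        · have hvy := Finset.ne_of_mem_erase hv
          refine Or.inr ⟨v, Finset.mem_of_mem_erase hv, ?_⟩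
          rw [← Finset.add_sum_erase _ _ hyF, Sandpile.topple, if_neg hvy, S.mult_comm v y]
          omega
    · rcases h.forbidden F hF with ⟨v, hv, hvT⟩ | ⟨v, hv, hle⟩
      · have hvy : v ≠ y := fun h => hyF (h ▸ hv)
        exact Or.inl ⟨v, hv, by simp [hvy, hvT]⟩
      · have hvy : v ≠ y := fun h => hyF (h ▸ hv)
        exact Or.inr ⟨v, hv, by rw [Sandpile.topple, if_neg hvy]; omega⟩
  weight v hv m hm := by
    rw [Set.mem_insert_iff, not_or] at hv
    have hg := isGreen_green (S := S) v.2
    rw [sum_mul_topple hg.sink hy, hg.laplace y y.2,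
      if_neg fun h => hv.1 (Subtype.ext h.symm), sub_zero]
    exact h.weight v hv.2 m hm

theorem Tracks.relaxes {k : ℕ} {T : Set S.Ordinary} {c c' : S.Config} (h : S.Tracks k T c)
    (hr : S.Relaxes c c') : ∃ T', S.Tracks k T' c' := by
  induction hr with
  | refl => exact ⟨T, h⟩
  | tail _ ht ih =>
    obtain ⟨T', h'⟩ := ih
    obtain ⟨v, hv, rfl⟩ := ht
    exact ⟨_, h'.topple hv⟩

theorem TransientRun.exists_tracks {k : ℕ} {c : S.Config} (h : S.TransientRun k c) :
    ∃ T, S.Tracks k T c := by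
  induction h with
  | empty => exact ⟨∅, Tracks.zero⟩
  | add v _ hr _ _ ih =>
    obtain ⟨T, hT⟩ := ih
    exact (hT.add v).relaxes hr

theorem TransientRun.not_recurrent {k : ℕ} {c : S.Config} (h : S.TransientRun k c) :
    ¬ S.Recurrent c := by
  cases h <;> assumption

theorem TransientRun.stable {k : ℕ} {c : S.Config} (h : S.TransientRun k c) : S.Stable c := by
  cases h with
  | empty => exact fun v => degree_pos v.2
  | add => assumption

/-- A nonrecurrent configuration has a forbidden set, and such a set contains a vertex `v` that has
never toppled. -/
theorem TransientRun.exists_le_sum {k : ℕ} {c : S.Config} (h : S.TransientRun k c) :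
    ∃ v : S.Ordinary, ∀ m : ℝ, (∀ w : S.Ordinary, m ≤ S.green v w) →
      k * m ≤ ∑ u : S.Ordinary, S.green v u * c u := by
  obtain ⟨T, hT⟩ := h.exists_tracks
  have hn := mt NoForbidden.recurrent h.not_recurrent
  simp only [NoForbidden, not_forall] at hn
  obtain ⟨F, hF, hn⟩ := hn
  obtain ⟨v, -, hv⟩ := (hT.forbidden F hF).resolve_right hn
  exact ⟨v, hT.weight v hv⟩

theorem green_pos (hS : S.ConnectedOffSink) (v w : S.Ordinary) : 0 < S.green v w :=
  (isGreen_green (S := S) v.2).pos hS w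

/-- Combine the lower bound for the weight with stability, which bounds each `c u` by `Δ`. -/
theorem TransientRun.le_mul (hS : S.ConnectedOffSink) {Δ : ℕ}
    (hΔ : ∀ v : S.Ordinary, S.degree v ≤ Δ) {A : ℝ}
    (hA : ∀ v w : S.Ordinary, ∑ u : S.Ordinary, S.green w u ≤ A * S.green w v)
    {k : ℕ} {c : S.Config} (h : S.TransientRun k c) : (k : ℝ) ≤ Δ * A := by
  obtain ⟨v, hv⟩ := h.exists_le_sum
  have hsum : 0 < ∑ u : S.Ordinary, S.green v u :=
    Finset.sum_pos (fun u _ => green_pos hS v u) ⟨v, Finset.mem_univ v⟩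
  have hApos : 0 < A := by
    have := hsum.trans_le (hA v v)
    exact pos_of_mul_pos_left this (green_pos hS v v).le
  have h1 := hv ((∑ u : S.Ordinary, S.green v u) / A) fun w => by
    rw [div_le_iff₀ hApos, mul_comm]; exact hA w v
  have h2 : ∑ u : S.Ordinary, S.green v u * c u ≤ Δ * ∑ u : S.Ordinary, S.green v u := by
    rw [Finset.mul_sum]
    refine Finset.sum_le_sum fun u _ => ?_
    rw [mul_comm]
    refine mul_le_mul_of_nonneg_right ?_ (green_pos hS v u).le
    exact_mod_cast (h.stable u).le.trans (hΔ u)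
  have h3 := h1.trans h2
  rw [← mul_div_assoc, div_le_iff₀ hApos] at h3
  refine le_of_mul_le_mul_right ?_ hsum
  linarith

/-- The weight by the Green function of the untoppled vertex is positive once a particle has been
added. -/
theorem TransientRun.ne_zero (hS : S.ConnectedOffSink) {k : ℕ} {c : S.Config}
    (h : S.TransientRun k c) (hk : 0 < k) : c ≠ 0 := by
  rintro rfl
  obtain ⟨v, hv⟩ := h.exists_le_sum
  obtain ⟨w, -, hw⟩ := Finset.exists_min_image Finset.univ (fun w : S.Ordinary => S.green v w)
    ⟨v, Finset.mem_univ v⟩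
  have := hv (S.green v w) fun u => hw u (Finset.mem_univ u)
  simp only [Pi.zero_apply, Nat.cast_zero, mul_zero, Finset.sum_const_zero] at this
  have h2 : (0 : ℝ) < k * S.green v w := mul_pos (Nat.cast_pos.2 hk) (green_pos hS v w)
  linarith

end Sandpile

/-! ### The lower bound and the estimate of the transience class -/

namespace Sandpile

variable {V : Type} [Fintype V] [DecidableEq V] {S : Sandpile V}

/-! ### The lower bound -/

variable (S) in
/-- Twice the number of edges between ordinary vertices. -/
def ordinaryTotal : ℕ := ∑ u : S.Ordinary, ∑ v : S.Ordinary, S.mult u v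

/-- Remove a good vertex of `F`: its particles pay for its edges into `F`. Repeating this pays for
every edge once, whereas the left side counts each edge twice. -/
theorem NoForbidden.sum_mult_le {c : S.Config} (hc : S.NoForbidden c) (F : Finset S.Ordinary) :
    ∑ u ∈ F, ∑ v ∈ F, S.mult u v ≤ 2 * ∑ u ∈ F, c u := by
  induction hk : F.card generalizing F with
  | zero => simp [Finset.card_eq_zero.1 hk]
  | succ k ih =>
    obtain ⟨v, hv, hle⟩ := hc F (Finset.card_pos.1 (by omega))
    have h := ih (F.erase v) (by rw [Finset.card_erase_of_mem hv]; omega)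
    have h1 : ∀ f : S.Ordinary → ℕ, ∑ u ∈ F, f u = f v + ∑ u ∈ F.erase v, f u := fun f =>
      (Finset.add_sum_erase _ _ hv).symm
    have h2 : ∑ u ∈ F.erase v, ∑ w ∈ F, S.mult u w = ∑ u ∈ F.erase v, S.mult v u +
        ∑ u ∈ F.erase v, ∑ w ∈ F.erase v, S.mult u w := by
      rw [← Finset.sum_add_distrib]
      exact Finset.sum_congr rfl fun u _ => by rw [h1, S.mult_comm]
    have h3 : ∑ u ∈ F, S.mult v u = ∑ u ∈ F.erase v, S.mult v u := by
      rw [h1, S.mult_self, zero_add]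
    rw [h1 fun u => ∑ w ∈ F, S.mult u w, h2, h1 c]
    omega

theorem exists_ordinary_adj (hS : S.ConnectedOffSink) {u v : S.Ordinary} (huv : u ≠ v) :
    ∃ w : S.Ordinary, 0 < S.mult u w := by
  obtain ⟨p⟩ := hS u v
  cases p with
  | nil => exact absurd rfl huv
  | cons h _ => exact ⟨_, h⟩

/-- A weak form of Harnack's inequality. -/
theorem green_le_mul {Δ : ℕ} (hΔ : ∀ v : S.Ordinary, S.degree v ≤ Δ)
    (w : S.Ordinary) {u v : S.Ordinary} (huv : 0 < S.mult u v) :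
    S.green w u ≤ Δ * S.green w v := by
  have hg := isGreen_green (S := S) w.2
  -- Superharmonicity at `v` bounds a single neighbour's value by `d(v)` times the value at `v`.
  have hl : 0 ≤ S.laplace (S.green w) v := by
    rw [hg.laplace v v.2]; split_ifs <;> norm_num
  rw [laplace] at hl
  have h1 : (S.mult v u : ℝ) * S.green w u ≤ ∑ x, (S.mult v x : ℝ) * S.green w x :=
    Finset.single_le_sum (f := fun x => (S.mult v x : ℝ) * S.green w x)
      (fun x _ => mul_nonneg (Nat.cast_nonneg _) (hg.nonneg x)) (Finset.mem_univ (u : V))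
  have h2 : (1 : ℝ) ≤ S.mult v u := by rw [S.mult_comm]; exact_mod_cast huv
  have h3 : (S.degree v : ℝ) * S.green w v ≤ Δ * S.green w v :=
    mul_le_mul_of_nonneg_right (by exact_mod_cast hΔ v) (hg.nonneg v)
  nlinarith [hg.nonneg u]

/-- An empty vertex charges its value to an occupied neighbour at the price of a Harnack factor `Δ`,
and each vertex is charged along at most `Δ` edges. -/
theorem NoForbidden.sum_green_le (hS : S.ConnectedOffSink) {Δ : ℕ}
    (hΔ : ∀ v : S.Ordinary, S.degree v ≤ Δ) (hadj : ∀ u : S.Ordinary, ∃ v : S.Ordinary, 0 < S.mult u v)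
    {c : S.Config} (hc : S.NoForbidden c) (w : S.Ordinary) :
    ∑ u : S.Ordinary, S.green w u ≤ (1 + Δ ^ 2) * ∑ u : S.Ordinary, S.green w u * c u := by
  have hpos := fun u : S.Ordinary => (green_pos hS w u).le
  have hterm : ∀ u v : S.Ordinary, 0 ≤ (S.mult u v : ℝ) * (S.green w v * c v) := fun u v =>
    mul_nonneg (Nat.cast_nonneg _) (mul_nonneg (hpos v) (Nat.cast_nonneg _))
  have h1 : ∀ u : S.Ordinary, S.green w u ≤
      S.green w u * c u + Δ * ∑ v : S.Ordinary, S.mult u v * (S.green w v * c v) := by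
    intro u
    have hn : 0 ≤ (Δ : ℝ) * ∑ v : S.Ordinary, S.mult u v * (S.green w v * c v) :=
      mul_nonneg (Nat.cast_nonneg _) (Finset.sum_nonneg fun v _ => hterm u v)
    rcases Nat.eq_zero_or_pos (c u) with h0 | h0
    · obtain ⟨v, hv⟩ := hadj u
      have huv : u ≠ v := by rintro rfl; rw [S.mult_self] at hv; omega
      have hcv : 1 ≤ c v := by
        -- The pair is not forbidden and `u` is empty, so `v` must be the occupied one.
        obtain ⟨x, hx, hle⟩ := hc {u, v} (by simp)
        rw [Finset.sum_pair huv] at hle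
        rcases Finset.mem_insert.1 hx with rfl | hx
        · omega
        · rw [Finset.mem_singleton] at hx
          subst hx
          rw [S.mult_comm x u] at hle
          omega
      have h2 := green_le_mul hΔ w hv
      have h3 : (S.mult u v : ℝ) * (S.green w v * c v) ≤
          ∑ v : S.Ordinary, S.mult u v * (S.green w v * c v) :=
        Finset.single_le_sum (f := fun v : S.Ordinary => (S.mult u v : ℝ) * (S.green w v * c v))
          (fun v _ => hterm u v) (Finset.mem_univ v)
      have h4 : S.green w v ≤ (S.mult u v : ℝ) * (S.green w v * c v) := by
        have e1 : (1 : ℝ) ≤ S.mult u v := by exact_mod_cast hv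
        have e2 : (1 : ℝ) ≤ c v := by exact_mod_cast hcv
        have e3 : S.green w v ≤ S.green w v * c v := le_mul_of_one_le_right (hpos v) e2
        exact e3.trans (le_mul_of_one_le_left ((hpos v).trans e3) e1)
      rw [h0]
      simp only [Nat.cast_zero, mul_zero, zero_add]
      exact h2.trans (mul_le_mul_of_nonneg_left (h4.trans h3) (Nat.cast_nonneg _))
    · have e2 : (1 : ℝ) ≤ c u := by exact_mod_cast h0
      have e3 : S.green w u ≤ S.green w u * c u := le_mul_of_one_le_right (hpos u) e2
      linarith
  have h2 := Finset.sum_le_sum fun u (_ : u ∈ Finset.univ) => h1 u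
  rw [Finset.sum_add_distrib, ← Finset.mul_sum, Finset.sum_comm] at h2
  have h3 : ∑ v : S.Ordinary, ∑ u : S.Ordinary, (S.mult u v : ℝ) * (S.green w v * c v) ≤
      Δ * ∑ v : S.Ordinary, S.green w v * c v := by
    rw [Finset.mul_sum]
    refine Finset.sum_le_sum fun v _ => ?_
    rw [← Finset.sum_mul]
    refine mul_le_mul_of_nonneg_right ?_ (mul_nonneg (hpos v) (Nat.cast_nonneg _))
    have : ∑ u : S.Ordinary, S.mult u v ≤ Δ := by
      refine le_trans ?_ (hΔ v)
      rw [degree, sum_ordinary (S := S)]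
      refine le_trans (le_of_eq ?_) (Nat.le_add_left _ _)
      exact Finset.sum_congr rfl fun u _ => S.mult_comm _ _
    exact_mod_cast this
  have h4 := mul_le_mul_of_nonneg_left h3 (Nat.cast_nonneg (α := ℝ) Δ)
  nlinarith

/-- All particles are added at `v`. Topplings never increase the weight by the superharmonic
function `S.green w`, so it stays below what recurrence requires. -/
theorem exists_transientRun (hS : S.ConnectedOffSink) {Δ : ℕ}
    (hΔ : ∀ v : S.Ordinary, S.degree v ≤ Δ)
    (hadj : ∀ u : S.Ordinary, ∃ v : S.Ordinary, 0 < S.mult u v) (v w : S.Ordinary) (k : ℕ)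
    (hk : (1 + Δ ^ 2) * (k * S.green w v) < ∑ u : S.Ordinary, S.green w u) :
    ∃ c, S.TransientRun k c ∧ ∑ u : S.Ordinary, S.green w u * c u ≤ k * S.green w v := by
  have hnot : ∀ (k : ℕ) (c : S.Config),
      (1 + Δ ^ 2) * (k * S.green w v) < ∑ u : S.Ordinary, S.green w u →
      ∑ u : S.Ordinary, S.green w u * c u ≤ k * S.green w v → ¬ S.Recurrent c := by
    intro k c hk hc hrec
    have h1 := hrec.noForbidden.sum_green_le hS hΔ hadj w
    have h2 : (1 + (Δ : ℝ) ^ 2) * ∑ u : S.Ordinary, S.green w u * c u ≤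
      (1 + Δ ^ 2) * (k * S.green w v) := mul_le_mul_of_nonneg_left hc (by positivity)
    linarith
  induction k with
  | zero =>
    have h0 : ∑ u : S.Ordinary, S.green w u * ((0 : S.Config) u : ℝ) ≤
        ((0 : ℕ) : ℝ) * S.green w v := by simp
    exact ⟨0, .empty (hnot 0 0 hk h0), h0⟩
  | succ k ih =>
    have hpos := green_pos hS w v
    obtain ⟨c, hc, hle⟩ := ih (lt_of_le_of_lt (by push_cast; gcongr; linarith) hk)
    obtain ⟨c', hr, hs⟩ := exists_relaxes_stable (c + Pi.single v 1)
    have hg := isGreen_green (S := S) w.2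
    have h1 := hr.sum_mul_le hg.sink fun x hx => by
      rw [hg.laplace x hx]; split_ifs <;> norm_num
    rw [sum_mul_add_single] at h1
    have h2 : ∑ u : S.Ordinary, S.green w u * c' u ≤ ((k + 1 : ℕ) : ℝ) * S.green w v := by
      push_cast; linarith
    exact ⟨c', .add v hc hr hs (hnot _ _ hk h2), h2⟩

/-- Recurrence needs at least as many particles as there are ordinary edges, here more than one. -/
theorem exists_transientRun_one (hS : 2 < S.ordinaryTotal) : ∃ c, S.TransientRun 1 c := by
  have hnot : ∀ c : S.Config, ∑ u, c u ≤ 1 → ¬ S.Recurrent c := fun c hc hrec => by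
    have : S.ordinaryTotal ≤ 2 * ∑ u, c u := hrec.noForbidden.sum_mult_le Finset.univ
    omega
  obtain ⟨v⟩ : Nonempty S.Ordinary := by
    by_contra h
    rw [not_nonempty_iff] at h
    simp [ordinaryTotal] at hS
  obtain ⟨c, hr, hs⟩ := exists_relaxes_stable (S := S) (0 + Pi.single v 1)
  refine ⟨c, .add v (.empty (hnot 0 (by simp))) hr hs (hnot c (hr.sum_le.trans ?_))⟩
  simp [Finset.sum_pi_single']

/-! ### The transience class -/

/-- A forbidden set must contain both ends of the only ordinary edge and find them empty. By
connectivity there are no other ordinary vertices, so the configuration is empty, which no added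
particle allows. -/
theorem TransientRun.eq_zero_of_total_le (hS : S.ConnectedOffSink) (ht : S.ordinaryTotal ≤ 2)
    {k : ℕ} {c : S.Config} (h : S.TransientRun k c) : k = 0 := by
  by_contra hk
  refine h.ne_zero hS (Nat.pos_of_ne_zero hk) ?_
  have hn := mt NoForbidden.recurrent h.not_recurrent
  simp only [NoForbidden, not_forall, not_exists, not_and, not_le] at hn
  obtain ⟨F, ⟨x, hx⟩, hF⟩ := hn
  obtain ⟨y, hyF, hy⟩ : ∃ y ∈ F, 0 < S.mult x y := by
    by_contra! h0
    have := hF x hx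
    rw [Finset.sum_eq_zero fun y hy => Nat.le_zero.1 (h0 y hy)] at this
    omega
  have hxy : x ≠ y := by rintro rfl; rw [S.mult_self] at hy; omega
  let m : S.Ordinary × S.Ordinary → ℕ := fun e => S.mult e.1 e.2
  have htot : ∀ E : Finset (S.Ordinary × S.Ordinary), ∑ e ∈ E, m e ≤ 2 := fun E =>
    (Finset.sum_le_sum_of_subset (Finset.subset_univ E)).trans
      (by rw [Fintype.sum_prod_type]; exact ht)
  have hyx : 0 < S.mult y x := by rwa [S.mult_comm]
  -- The ordered pairs `(x, y)` and `(y, x)` already exhaust the total of 2.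
  have h2 : ∀ z z' : S.Ordinary, (z, z') ≠ (x, y) → (z, z') ≠ (y, x) → S.mult z z' = 0 := by
    intro z z' h1 h2
    have := htot {(z, z'), (x, y), (y, x)}
    rw [Finset.sum_insert (by simp at h1 h2 ⊢; tauto), Finset.sum_pair (by simp [hxy])] at this
    simp only [m] at this
    omega
  have h3 := htot {(x, y), (y, x)}
  rw [Finset.sum_pair (by simp [hxy])] at h3
  simp only [m] at h3
  funext z
  by_cases hzx : z = x
  · subst hzx
    have := hF z hx
    rw [Finset.sum_eq_single_of_mem y hyF fun w _ hw => h2 z w (by simp [hw]) (by simp [hxy])]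
      at this
    simp only [Pi.zero_apply]
    omega
  by_cases hzy : z = y
  · subst hzy
    have := hF z hyF
    rw [Finset.sum_eq_single_of_mem x hx fun w _ hw => h2 z w (by simp [hxy.symm]) (by simp [hw])]
      at this
    simp only [Pi.zero_apply]
    omega
  · obtain ⟨z', hz'⟩ := exists_ordinary_adj hS hzx
    rw [h2 z z' (by simp [hzx]) (by simp [hzy])] at hz'
    omega

theorem le_tcl {k : ℕ} {c : S.Config} (h : S.TransientRun k c) : (k : ℕ∞) ≤ S.tcl :=
  le_iSup₂ (f := fun (k : ℕ) (_ : k ∈ {k : ℕ | ∃ c, S.TransientRun k c}) => (k : ℕ∞)) k ⟨c, h⟩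

theorem tcl_le {K : ℕ} (h : ∀ k c, S.TransientRun k c → k ≤ K) : S.tcl ≤ K :=
  iSup₂_le fun k ⟨c, hc⟩ => by exact_mod_cast h k c hc

theorem tcl_eq_zero (hS : S.ConnectedOffSink) (ht : S.ordinaryTotal ≤ 2) : S.tcl = 0 :=
  le_antisymm (tcl_le fun _ _ h => (h.eq_zero_of_total_le hS ht).le) bot_le

theorem exists_adj_of_total (hS : S.ConnectedOffSink) (ht : 2 < S.ordinaryTotal) (u : S.Ordinary) :
    ∃ v : S.Ordinary, 0 < S.mult u v := by
  by_cases h : ∃ v : S.Ordinary, u ≠ v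
  · obtain ⟨v, hv⟩ := h
    exact exists_ordinary_adj hS hv
  · push Not at h
    have : S.ordinaryTotal = 0 := Finset.sum_eq_zero fun x _ => Finset.sum_eq_zero fun y _ => by
      rw [← h x, ← h y, S.mult_self]
    omega

theorem tcl_bounds (hS : S.ConnectedOffSink) {Δ : ℕ} (hΔ : ∀ v : S.Ordinary, S.degree v ≤ Δ)
    (ht : 2 < S.ordinaryTotal) {p q : ℕ} (hq : 0 < q)
    (hA : IsGreatest S.potentialEstimates ((p : ℝ) / q)) :
    (q : ℕ∞) * S.tcl ≤ (2 * (1 + Δ ^ 2) : ℕ) * p ∧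
      (p : ℕ∞) ≤ (2 * (1 + Δ ^ 2) : ℕ) * (q * S.tcl) := by
  have hq' : (0 : ℝ) < q := Nat.cast_pos.2 hq
  rw [potentialEstimates_eq hS] at hA
  obtain ⟨⟨v, w, hvw⟩, hub⟩ := hA
  have hpos := green_pos hS w v
  constructor
  · have hle : ∀ k c, S.TransientRun k c → k ≤ 2 * (1 + Δ ^ 2) * p / q := by
      intro k c h
      have h1 := h.le_mul hS hΔ (A := (p : ℝ) / q) fun v w => by
        rw [← div_le_iff₀ (green_pos hS w v)]
        exact hub ⟨v, w, rfl⟩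
      rw [Nat.le_div_iff_mul_le hq]
      rw [← mul_div_assoc, le_div_iff₀ hq'] at h1
      have h2 : k * q ≤ Δ * p := by exact_mod_cast h1
      refine h2.trans (Nat.mul_le_mul_right _ ?_)
      nlinarith [sq_nonneg ((Δ : ℤ) - 1)]
    calc (q : ℕ∞) * S.tcl ≤ q * (2 * (1 + Δ ^ 2) * p / q : ℕ) := by gcongr; exact tcl_le hle
      _ ≤ _ := by exact_mod_cast Nat.mul_div_le _ _
  · suffices ∃ k c, S.TransientRun k c ∧ p ≤ 2 * (1 + Δ ^ 2) * (q * k) by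
      obtain ⟨k, c, hc, hle⟩ := this
      calc (p : ℕ∞) ≤ (2 * (1 + Δ ^ 2) : ℕ) * (q * k) := by exact_mod_cast hle
        _ ≤ _ := by gcongr; exact le_tcl hc
    have hrun : ∀ k : ℕ, (1 + Δ ^ 2) * (q * k) < p → ∃ c, S.TransientRun k c := by
      intro k hk
      obtain ⟨c, hc, -⟩ := exists_transientRun hS hΔ (exists_adj_of_total hS ht) v w k (by
        have h1 : ((1 + Δ ^ 2 : ℕ) : ℝ) * (q * k) < p := by exact_mod_cast hk
        have h2 : ((1 + Δ ^ 2 : ℕ) : ℝ) * k < p / q := by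
          rw [lt_div_iff₀ hq']; linarith
        rw [hvw, lt_div_iff₀ hpos] at h2
        push_cast at h2
        linarith)
      exact ⟨c, hc⟩
    -- If the estimate is at most `2 * (1 + Δ ^ 2)`, one particle suffices; this is where `2 <
    -- S.ordinaryTotal` enters through `exists_transientRun_one`.
    by_cases h1 : p ≤ (1 + Δ ^ 2) * (q * 2)
    · obtain ⟨c, hc⟩ := exists_transientRun_one ht
      exact ⟨1, c, hc, by linarith⟩
    · have hM : 0 < (1 + Δ ^ 2) * q := by positivity
      have h1' : (1 + Δ ^ 2) * q * 2 < p := by rw [mul_assoc]; omega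
      -- The largest `k` with `(1 + Δ ^ 2) * q * k < p`. As `k ≥ 1`, passing from `k + 1` to `2 * k`
      -- costs the factor 2 in the constant.
      set k := (p - 1) / ((1 + Δ ^ 2) * q)
      have hk1 : (1 + Δ ^ 2) * q * k ≤ p - 1 := Nat.mul_div_le _ _
      have hk2 : p - 1 < (1 + Δ ^ 2) * q * (k + 1) := Nat.lt_mul_div_succ _ hM
      clear_value k
      obtain ⟨c, hc⟩ := hrun k (by rw [← mul_assoc]; omega)
      refine ⟨k, c, hc, ?_⟩
      have hk3 : 1 ≤ k := by
        by_contra h0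
        have : k = 0 := by omega
        rw [this, zero_add, mul_one] at hk2
        omega
      have : (1 + Δ ^ 2) * q * (k + 1) ≤ (1 + Δ ^ 2) * q * (2 * k) :=
        Nat.mul_le_mul_left _ (by omega)
      have h5 : (1 + Δ ^ 2) * q * (2 * k) = 2 * (1 + Δ ^ 2) * (q * k) := by ring
      omega

end Sandpile

/-! ### Matrix loops on the machine -/

namespace RAM

/-! ### Loops over the cells of a square matrix

The size of the matrix is in register `0`. -/

/-- The entry in bank `a` whose row and column are in registers `x` and `y`. -/
def Expr.cell (a x y : ℕ) : Expr := .load a (.add (.mul (.reg x) (.reg 0)) (.reg y))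

/-- An expression that is positive if registers `x` and `y` differ, and `0` otherwise. -/
def Expr.distinct (x y : ℕ) : Expr := .mul (.sub (.reg x) (.reg y)) (.sub (.reg x) (.reg y))

theorem Expr.distinct_pos {x y : ℕ} {s : State} {m k : ℕ} (hx : s.reg x = m) (hy : s.reg y = k) :
    0 < (Expr.distinct x y).eval s ↔ m ≠ k := by
  simp only [Expr.distinct, Expr.eval, hx, hy, mul_self_pos, sub_ne_zero]
  exact_mod_cast Iff.rfl

theorem Expr.eval_cell {a x y : ℕ} {s : State} {n i j : ℕ} (h0 : s.reg 0 = n) (hx : s.reg x = i)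
    (hy : s.reg y = j) : (Expr.cell a x y).eval s = s.mem a (i * n + j) := by
  simp only [Expr.cell, Expr.eval, h0, hx, hy]
  norm_cast

/-- Run `P` for every cell; the index of the cell, its row and its column are in registers
`2`, `3` and `4`. -/
def Program.forCells (P : Program) : Program :=
  .forLoop 2 (.mul (.reg 0) (.reg 0)) (.seq (.assign 3 (.div (.reg 2) (.reg 0)))
    (.seq (.assign 4 (.sub (.reg 2) (.mul (.reg 3) (.reg 0)))) P))

/-- A single loop over `i * n + j` replaces two nested ones. Recovering row and column accounts for
four of the seven extra steps, the counting loop for three. -/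
theorem Runs.forCells {b : ℕ} (hb : 1 ≤ b) {P : Program} {s : State} (k : ℕ) {n K : ℕ}
    {Q : State → Prop} (I : ℕ → State → Prop) (hn : n * n < 2 ^ b) (h0P : 0 ∉ P.regs)
    (h2P : 2 ∉ P.regs) (hs : s.reg 0 = n)
    (hI : ∀ m s x z, x ∈ [2, 3, 4] → I m s → I m (s.setReg x z)) (h0 : I 0 s)
    (hstep : ∀ (i j : Fin n) (s' : State), Agree (2 :: 3 :: 4 :: P.regs) P.banks s s' →
      s'.reg 2 = ((i * n + j : ℕ) : ℤ) → s'.reg 3 = (i : ℕ) → s'.reg 4 = (j : ℕ) →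
      I (i * n + j) s' → Runs b P s' k (I (i * n + j + 1)))
    (hQ : ∀ s', Agree (2 :: 3 :: 4 :: P.regs) P.banks s s' → I (n * n) s' → Q s')
    (hK : n * n * (k + 7) + 3 ≤ K := by omega) : Runs b (.forCells P) s K Q := by
  have hA : ∀ s', Agree (2 :: 3 :: 4 :: P.regs) P.banks s s' → s'.reg 0 = n := fun s' h => by
    rw [h.1 0 (by simp [h0P]), hs]
  refine Runs.forLoop hb (k + 4) (n * n) I hn (by decide) ?_ (fun s' h => ?_) ?_ h0 ?_ hQ
  · simpa [Program.regs] using h2P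
  · simp only [Expr.eval, hA s' h, Nat.cast_mul]
  · exact fun m s z h => hI m s 2 z (by simp) h
  · intro m hm s' h h2 hi
    have h' : Agree (2 :: 3 :: 4 :: P.regs) P.banks s s' := h
    have hn0 : 0 < n := Nat.pos_of_mul_pos_left (Nat.zero_lt_of_lt hm)
    have hnm : n ≤ n * n := Nat.le_mul_of_pos_left n hn0
    have hdiv : m / n < n := Nat.div_lt_of_lt_mul hm
    have hmod : m % n < n := Nat.mod_lt _ hn0
    have hm' : m / n * n + m % n = m := Nat.div_add_mod' m n
    have e3 : (Expr.div (.reg 2) (.reg 0)).eval s' = ((m / n : ℕ) : ℤ) := by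
      simp [Expr.eval, h2, hA s' h']
    refine Runs.seq 1 (k + 2) (Runs.assign hb (by decide) (fun _ => ?_) ?_)
    · rw [e3, Int.natAbs_natCast]; omega
    rw [e3]
    have e4 : (Expr.sub (.reg 2) (.mul (.reg 3) (.reg 0))).eval (s'.setReg 3 ((m / n : ℕ) : ℤ)) =
        ((m % n : ℕ) : ℤ) := by
      simp only [Expr.eval, State.reg_setReg, h2, hA s' h']
      norm_num
      have : ((m / n * n + m % n : ℕ) : ℤ) = m := by rw [hm']
      push_cast at this
      linarith
    refine Runs.seq 1 k (Runs.assign hb (by decide) (fun _ => ?_) ?_)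
    · rw [e4, Int.natAbs_natCast]; omega
    rw [e4]
    have := hstep ⟨m / n, hdiv⟩ ⟨m % n, hmod⟩
      ((s'.setReg 3 ((m / n : ℕ) : ℤ)).setReg 4 ((m % n : ℕ) : ℤ))
      ((h'.setReg (by simp) _).setReg (by simp) _) (by simp [h2, hm']) (by simp) (by simp)
    simp only [hm'] at this
    exact this (hI _ _ _ _ (by simp) (hI _ _ _ _ (by simp) hi))

/-- Bank `a` holds the matrix `A`, as far as the cells before `m` are concerned. -/
def HoldsUpTo {n : ℕ} (m : ℕ) (s : State) (a : ℕ) (A : Matrix (Fin n) (Fin n) ℤ) : Prop :=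
  ∀ i j : Fin n, (i * n + j : ℕ) < m → s.mem a (i * n + j) = A i j

/-- Bank `a` holds the matrix `A`, row by row. -/
def Holds {n : ℕ} (s : State) (a : ℕ) (A : Matrix (Fin n) (Fin n) ℤ) : Prop :=
  ∀ i j : Fin n, s.mem a (i * n + j) = A i j

theorem cell_lt {n : ℕ} (i j : Fin n) : (i * n + j : ℕ) < n * n := by
  have := i.2
  have := j.2
  nlinarith

theorem cell_inj {n : ℕ} {i j i' j' : Fin n} (h : (i * n + j : ℕ) = i' * n + j') :
    i = i' ∧ j = j' := by
  have hn : 0 < n := i.pos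
  have h1 := congrArg (· / n) h
  have h2 := congrArg (· % n) h
  simp only [Fin.is_lt, mul_comm _ n, Nat.mul_add_div hn,
    Nat.div_eq_of_lt, Nat.mul_add_mod, Nat.mod_eq_of_lt, add_zero] at h1 h2
  exact ⟨Fin.ext h1, Fin.ext h2⟩

theorem HoldsUpTo.holds {n : ℕ} {s : State} {a : ℕ} {A : Matrix (Fin n) (Fin n) ℤ}
    (h : HoldsUpTo (n * n) s a A) : Holds s a A := fun i j => h i j (cell_lt i j)

theorem HoldsUpTo.setReg {n m : ℕ} {s : State} {a : ℕ} {A : Matrix (Fin n) (Fin n) ℤ}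
    (h : HoldsUpTo m s a A) (x : ℕ) (z : ℤ) : HoldsUpTo m (s.setReg x z) a A := h

theorem HoldsUpTo.zero {n : ℕ} (s : State) (a : ℕ) (A : Matrix (Fin n) (Fin n) ℤ) :
    HoldsUpTo 0 s a A := fun _ _ h => absurd h (Nat.not_lt_zero _)

theorem HoldsUpTo.setMem {n : ℕ} {s : State} {a : ℕ} {A : Matrix (Fin n) (Fin n) ℤ}
    {i j : Fin n} (h : HoldsUpTo (i * n + j) s a A) :
    HoldsUpTo (i * n + j + 1) (s.setMem a (i * n + j) (A i j)) a A := by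
  intro i' j' h'
  rw [State.mem_setMem]
  by_cases he : (i' * n + j' : ℕ) = i * n + j
  · obtain ⟨rfl, rfl⟩ := cell_inj he
    simp
  · rw [if_neg (by simp [he])]
    exact h i' j' (by omega)

theorem Holds.congr {n : ℕ} {s s' : State} {a : ℕ} {A : Matrix (Fin n) (Fin n) ℤ}
    (h : Holds s a A) (he : s'.mem a = s.mem a) : Holds s' a A := fun i j => by
  rw [he, h i j]

/-- Storing the entry `A i j` in the cell `(i, j)`. -/
theorem Runs.storeCell {b K : ℕ} (hb : 1 ≤ b) {n a : ℕ} {s : State} {e : Expr}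
    {A : Matrix (Fin n) (Fin n) ℤ} {i j : Fin n} {Q : State → Prop}
    (h2 : s.reg 2 = ((i * n + j : ℕ) : ℤ)) (hw : e.weight ≤ 30) (he : e.eval s = A i j)
    (hA : Bounded b s → (A i j).natAbs < 2 ^ b)
    (hQ : Q (s.setMem a (i * n + j) (A i j))) (hK : 1 ≤ K := by omega) :
    Runs b (.store a (.reg 2) e) s K Q := by
  refine Runs.store hb (by decide) hw (by rwa [he]) ?_ hK
  rw [he]
  simpa only [Expr.eval, h2, Int.toNat_natCast] using hQ

/-- Copy the matrix in bank `a` to bank `c`. -/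
def Program.copy (a c : ℕ) : Program := .forCells (.store c (.reg 2) (.load a (.reg 2)))

theorem Runs.copy {b : ℕ} (hb : 1 ≤ b) {s : State} {n a c K : ℕ} (hac : a ≠ c)
    (hn : n * n < 2 ^ b) (hs : s.reg 0 = n) {A : Matrix (Fin n) (Fin n) ℤ} (hA : Holds s a A)
    (hK : n * n * 8 + 3 ≤ K := by omega) :
    Runs b (.copy a c) s K fun s' => Holds s' c A := by
  refine Runs.forCells hb 1 (fun m s => HoldsUpTo m s c A) hn (by simp [Program.regs])
    (by simp [Program.regs]) hs (fun _ _ _ _ _ h => h) (HoldsUpTo.zero _ _ _) ?_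
    (fun _ _ h => h.holds)
  intro i j s' h h2 h3 h4 hi
  have hmem : s'.mem a = s.mem a := h.2 a (by simpa [Program.banks] using hac)
  have he : (Expr.load a (.reg 2)).eval s' = A i j := by
    simp only [Expr.eval, h2, Int.toNat_natCast, hmem, hA i j]
  refine Runs.storeCell hb h2 (by simp [Expr.weight]) he (fun hB => ?_) hi.setMem
  rw [← hA i j, ← hmem]
  exact hB.2 _ _

/-- Add up the row of the matrix in bank `a` whose index is in register `3`. -/
def Program.rowSum (a : ℕ) : Program :=
  .seq (.assign 6 (.const 0)) (.forLoop 5 (.reg 0) (.assign 6 (.add (.reg 6) (.cell a 3 5))))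

theorem Runs.rowSum {b : ℕ} (hb : 1 ≤ b) {s : State} {n a K X : ℕ} {i : Fin n}
    (hn : n < 2 ^ b) (hs : s.reg 0 = n) (hi : s.reg 3 = (i : ℕ)) {A : Matrix (Fin n) (Fin n) ℤ}
    (hA : Holds s a A) (hX : ∀ j, (A i j).natAbs ≤ X) (hb' : n * X < 2 ^ b)
    (hK : n * 4 + 5 ≤ K := by omega) :
    Runs b (.rowSum a) s K fun s' => s'.reg 6 = ∑ j, A i j := by
  refine Runs.seq 1 (n * 4 + 3) (Runs.assign hb (by decide) (fun _ => by simp [Expr.eval]) ?_)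
  refine Runs.forLoop hb 1 n (fun m s' => s'.reg 6 = ∑ l ∈ Finset.range m, s.mem a (i * n + l)) hn
    (by decide) (by simp [Program.regs]) (fun s' h => ?_) (fun m s z h => by simpa using h)
    (by simp [Expr.eval]) ?_ (fun s' _ h => ?_)
  · rw [Expr.eval, h.1 0 (by simp [Program.regs])]; simpa using hs
  · intro m hm s' h h5 h6
    have h0 : s'.reg 0 = n := by rw [h.1 0 (by simp [Program.regs])]; simpa using hs
    have h3 : s'.reg 3 = (i : ℕ) := by rw [h.1 3 (by simp [Program.regs])]; simpa using hi
    have hmem : s'.mem a = s.mem a := h.2 a (by simp [Program.banks])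
    have he : (Expr.add (.reg 6) (.cell a 3 5)).eval s' =
        ∑ l ∈ Finset.range (m + 1), s.mem a (i * n + l) := by
      rw [Expr.eval, Expr.eval_cell h0 h3 h5, Finset.sum_range_succ, hmem, Expr.eval, h6]
    refine Runs.assign hb (by simp [Expr.weight, Expr.cell]) (fun _ => ?_) ?_
    · rw [he]
      refine lt_of_le_of_lt ?_ hb'
      refine (Int.natAbs_sum_le _ _).trans ((Finset.sum_le_card_nsmul _ _ X ?_).trans ?_)
      · intro l hl
        have hl' : l < n := by have := Finset.mem_range.1 hl; omega
        have := hA i ⟨l, hl'⟩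
        simp only at this
        rw [this]
        exact hX _
      · rw [Finset.card_range, smul_eq_mul]
        exact Nat.mul_le_mul_right _ hm
    · simpa using he
  · rw [h, Finset.sum_range]
    exact Finset.sum_congr rfl fun j _ => hA i j

end RAM

/-! ### Elimination and maximization on the machine -/

namespace RAM

open Matrix

/-! ### Computing the adjugate -/

/-- One exchange step in bank `1`; the index and the value of the pivot are in registers `7` and
`8`, the previous pivot is in register `9`. The result is in bank `2`. -/
def Program.exchange : Program :=
  .forCells (.ite (.distinct 3 7)
    (.ite (.distinct 4 7)
      (.store 2 (.reg 2) (.div (.sub (.mul (.reg 8) (.load 1 (.reg 2)))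
        (.mul (.cell 1 3 7) (.cell 1 7 4))) (.reg 9)))
      (.store 2 (.reg 2) (.load 1 (.reg 2))))
    (.ite (.distinct 4 7)
      (.store 2 (.reg 2) (.sub (.const 0) (.load 1 (.reg 2))))
      (.store 2 (.reg 2) (.reg 9))))

/-- By `hB` the quotient computed off the pivot row and column is exact, so rounding is harmless; in
the other three cases a factor `d` cancels and nothing is divided. A second bank is needed since the
old pivot row and column are read throughout. -/
theorem Runs.exchange {b : ℕ} (hb : 1 ≤ b) {s : State} {n K : ℕ} (hn : n * n < 2 ^ b)
    (hs : s.reg 0 = n) {A B : Matrix (Fin n) (Fin n) ℤ} {k : Fin n} {d : ℤ} (hA : Holds s 1 A)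
    (h7 : s.reg 7 = (k : ℕ)) (h8 : s.reg 8 = A k k) (h9 : s.reg 9 = d) (hd : d ≠ 0)
    (hB : Matrix.exchange A d k = d • B) (hBb : ∀ i j, (B i j).natAbs < 2 ^ b)
    (hK : n * n * 10 + 3 ≤ K := by omega) :
    Runs b .exchange s K fun s' => Holds s' 2 B := by
  refine Runs.forCells hb 3 (fun m s => HoldsUpTo m s 2 B) hn (by decide) (by decide) hs
    (fun _ _ _ _ _ h => h) (HoldsUpTo.zero _ _ _) ?_ (fun _ _ h => h.holds)
  intro i j s' h h2 h3 h4 hi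
  have hA' : Holds s' 1 A := hA.congr (h.2 1 (by decide))
  have h0' : s'.reg 0 = n := by rw [h.1 0 (by decide), hs]
  have h7' : s'.reg 7 = (k : ℕ) := by rw [h.1 7 (by decide), h7]
  have h8' : s'.reg 8 = A k k := by rw [h.1 8 (by decide), h8]
  have h9' : s'.reg 9 = d := by rw [h.1 9 (by decide), h9]
  have hB' : Matrix.exchange A d k i j = d * B i j := by rw [hB]; simp
  have hload : (Expr.load 1 (.reg 2)).eval s' = A i j := by
    simp only [Expr.eval, h2, Int.toNat_natCast, hA' i j]
  simp only [Matrix.exchange] at hB'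
  refine Runs.ite hb 2 (by decide) (fun hik => ?_) (fun hik => ?_) <;>
    rw [Expr.distinct_pos h3 h7', ne_eq, Fin.val_inj] at hik <;>
    refine Runs.ite hb 1 (by decide) (fun hjk => ?_) (fun hjk => ?_) <;>
    rw [Expr.distinct_pos h4 h7', ne_eq, Fin.val_inj] at hjk <;>
    refine Runs.storeCell hb h2 (by decide) ?_ (fun _ => hBb i j) hi.setMem
  · rw [if_neg hik, if_neg hjk] at hB'
    change (s'.reg 8 * (Expr.load 1 (.reg 2)).eval s' -
      (Expr.cell 1 3 7).eval s' * (Expr.cell 1 7 4).eval s') / s'.reg 9 = B i j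
    rw [Expr.eval_cell h0' h3 h7', Expr.eval_cell h0' h7' h4, hload, hA' i k, hA' k j, h8', h9',
      hB', Int.mul_ediv_cancel_left _ hd]
  · rw [not_not] at hjk
    subst hjk
    rw [if_neg hik, if_pos rfl] at hB'
    rw [hload]
    exact mul_left_cancel₀ hd hB'
  · rw [not_not] at hik
    subst hik
    rw [if_pos rfl, if_neg hjk] at hB'
    rw [Expr.eval, hload, Expr.eval, zero_sub]
    exact mul_left_cancel₀ hd (by rw [← hB']; ring)
  · rw [not_not] at hik hjk
    subst hik hjk
    rw [if_pos rfl, if_pos rfl] at hB'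
    rw [Expr.eval, h9']
    exact mul_left_cancel₀ hd hB'

/-- Replace the matrix in bank `1` by its adjugate. -/
def Program.adjugate : Program :=
  .seq (.assign 9 (.const 1)) (.forLoop 7 (.reg 0)
    (.seq (.assign 8 (.cell 1 7 7)) (.seq .exchange (.seq (.copy 2 1) (.assign 9 (.reg 8))))))

theorem Runs.adjugate {b : ℕ} (hb : 1 ≤ b) {s : State} {n K : ℕ} (hn' : n < 2 ^ b)
    (hn : n * n < 2 ^ b) (hs : s.reg 0 = n) {A : Matrix (Fin n) (Fin n) ℤ} (hA : Holds s 1 A)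
    (hdet : ∀ k, (mixRows k A 1).det ≠ 0)
    (hbd : ∀ k i j, (partialAdjugate A k i j).natAbs < 2 ^ b)
    (hK : n * (n * n * 18 + 14) + 5 ≤ K := by omega) :
    Runs b .adjugate s K fun s' => Holds s' 1 A.adjugate := by
  refine Runs.seq 1 (n * (n * n * 18 + 14) + 3)
    (Runs.assign hb (by decide) (fun _ => ?_) ?_)
  · have := Nat.one_lt_two_pow (n := b) (by omega)
    simpa [Expr.eval] using this
  refine Runs.forLoop hb (n * n * 18 + 11) n
    (fun k s => Holds s 1 (partialAdjugate A k) ∧ s.reg 9 = (mixRows k A 1).det) hn' (by decide)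
    (by decide) (fun s' h => ?_) (fun m s z h => ⟨h.1, by simpa using h.2⟩) ⟨?_, ?_⟩ ?_
    (fun s' _ h => by rw [← partialAdjugate_self]; exact h.1) (le_refl _)
  · rw [Expr.eval, h.1 0 (by decide)]; simpa using hs
  · rw [partialAdjugate_zero]; exact hA
  · rw [det_mixRows_zero]; simp [Expr.eval]
  · rintro k hk s₁ h h7 ⟨hk1, hk9⟩
    have h0 : s₁.reg 0 = n := by rw [h.1 0 (by decide)]; simpa using hs
    have hcell : (Expr.cell 1 7 7).eval s₁ = partialAdjugate A k ⟨k, hk⟩ ⟨k, hk⟩ := by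
      rw [Expr.eval_cell h0 h7 h7]; exact hk1 ⟨k, hk⟩ ⟨k, hk⟩
    refine Runs.seq 1 (n * n * 18 + 9) (Runs.assign hb (by decide)
      (fun _ => by rw [hcell]; exact hbd _ _ _) ?_)
    rw [hcell]
    refine Runs.seq (n * n * 10 + 3) (n * n * 8 + 5) ((Runs.exchange hb
      (s := s₁.setReg 8 _) hn (by simpa using h0)
      (A := partialAdjugate A k) (B := partialAdjugate A (k + 1)) (k := ⟨k, hk⟩) hk1
      (by simpa using h7) (by simp) (by simpa using hk9) (hdet k)
      (exchange_partialAdjugate A hk (hdet (k + 1))) (hbd (k + 1)) (le_refl _)).mono le_rfl ?_)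
    intro s₂ ha h2
    have h0' : s₂.reg 0 = n := by rw [ha.1 0 (by decide)]; simpa using h0
    refine Runs.seq (n * n * 8 + 3) 1 ((Runs.copy hb (by decide) hn h0' h2).mono le_rfl ?_)
    intro s₃ ha' h1
    -- The pivot was saved before its cell was overwritten; it becomes the next divisor.
    have h8 : s₃.reg 8 = (mixRows (k + 1) A 1).det := by
      rw [ha'.1 8 (by decide), ha.1 8 (by decide), det_mixRows_succ A hk]
      simp
    refine Runs.assign hb (by decide) (fun hB => hB.1 8) ⟨h1, ?_⟩
    simpa [Expr.eval] using h8

/-! ### Maximizing ratios -/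

/-- Compute in registers `11` and `12` the numerator and the denominator of the maximal ratio of a
row sum to an entry of the matrix in bank `1`, the row and the column whose index is in register
`1` being left out. -/
def Program.maximize : Program :=
  .seq (.assign 12 (.const 1)) (.forCells (.seq (.rowSum 1) (.ite (.distinct 3 1)
    (.ite (.distinct 4 1)
      (.seq (.assign 13 (.mul (.reg 6) (.load 1 (.reg 2))))
        (.seq (.assign 14 (.mul (.load 1 (.reg 2)) (.load 1 (.reg 2))))
          (.ite (.sub (.mul (.reg 13) (.reg 12)) (.mul (.reg 11) (.reg 14)))
            (.seq (.assign 11 (.reg 13)) (.assign 12 (.reg 14))) .skip)))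
      .skip) .skip)))

/-- The fraction `p / q` is the maximum of `0` and of the ratios `N i j / D i j` for the cells
before `m`, the row and the column of `o` being left out. -/
structure IsMaxRatio {n : ℕ} (N D : Fin n → Fin n → ℤ) (o : Fin n) (m : ℕ) (p q : ℤ) : Prop where
  num_nonneg : 0 ≤ p
  den_pos : 0 < q
  le : ∀ i j, i ≠ o → j ≠ o → (i * n + j : ℕ) < m → N i j * q ≤ p * D i j
  attained : p = 0 ∨ ∃ i j, i ≠ o ∧ j ≠ o ∧ p = N i j ∧ q = D i j

theorem IsMaxRatio.zero {n : ℕ} (N D : Fin n → Fin n → ℤ) (o : Fin n) :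
    IsMaxRatio N D o 0 0 1 :=
  ⟨le_rfl, one_pos, fun _ _ _ _ h => absurd h (Nat.not_lt_zero _), Or.inl rfl⟩

theorem IsMaxRatio.succ {n : ℕ} {N D : Fin n → Fin n → ℤ} {o : Fin n} {i j : Fin n} {p q : ℤ}
    (h : IsMaxRatio N D o (i * n + j) p q) (hij : i ≠ o → j ≠ o → N i j * q ≤ p * D i j) :
    IsMaxRatio N D o (i * n + j + 1) p q := by
  refine ⟨h.1, h.2, fun i' j' hi' hj' hlt => ?_, h.4⟩
  rcases Nat.lt_succ_iff_lt_or_eq.1 hlt with hlt | he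
  · exact h.le i' j' hi' hj' hlt
  · obtain ⟨rfl, rfl⟩ := cell_inj he
    exact hij hi' hj'

theorem IsMaxRatio.replace {n : ℕ} {N D : Fin n → Fin n → ℤ} {o : Fin n} {i j : Fin n} {p q : ℤ}
    (h : IsMaxRatio N D o (i * n + j) p q) (hi : i ≠ o) (hj : j ≠ o)
    (hD : ∀ i j, i ≠ o → j ≠ o → 0 < D i j) (hlt : p * D i j < N i j * q) :
    IsMaxRatio N D o (i * n + j + 1) (N i j) (D i j) := by
  have hDij := hD i j hi hj
  refine ⟨?_, hDij, fun i' j' hi' hj' hlt' => ?_, Or.inr ⟨i, j, hi, hj, rfl, rfl⟩⟩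
  · have : 0 < N i j * q := lt_of_le_of_lt (mul_nonneg h.1 hDij.le) hlt
    exact (pos_of_mul_pos_left this h.2.le).le
  · rcases Nat.lt_succ_iff_lt_or_eq.1 hlt' with hlt' | he
    · have h1 := h.le i' j' hi' hj' hlt'
      have hD' := hD i' j' hi' hj'
      -- Transitivity of comparing fractions by cross multiplication, the old denominator being
      -- cancelled.
      refine le_of_mul_le_mul_right ?_ h.2
      nlinarith
    · obtain ⟨rfl, rfl⟩ := cell_inj he
      exact le_rfl

/-- Numerator and denominator are both multiplied by the entry, which makes the denominator a
positive square whatever the sign of the determinant. The cross products in the comparison are never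
stored, so only `N` and `D` must fit into `b` bits. -/
theorem Runs.maximize {b : ℕ} (hb : 1 ≤ b) {s : State} {n K : ℕ} (hn' : n < 2 ^ b)
    (hn : n * n < 2 ^ b) (hs : s.reg 0 = n) {o : Fin n} (ho : s.reg 1 = (o : ℕ))
    (h11 : s.reg 11 = 0) {B : Matrix (Fin n) (Fin n) ℤ} (hB : Holds s 1 B)
    (hB0 : ∀ i j, i ≠ o → j ≠ o → B i j ≠ 0) {Y : ℕ} (hY : ∀ i j, (B i j).natAbs ≤ Y)
    (hYb : n * Y < 2 ^ b) (hYY : n * Y * Y < 2 ^ b)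
    (hK : n * n * (n * 4 + 25) + 5 ≤ K := by omega) :
    Runs b .maximize s K fun s' =>
      IsMaxRatio (fun i j => (∑ u, B i u) * B i j) (fun i j => B i j * B i j) o (n * n)
        (s'.reg 11) (s'.reg 12) := by
  set N : Fin n → Fin n → ℤ := fun i j => (∑ u, B i u) * B i j with hN
  set D : Fin n → Fin n → ℤ := fun i j => B i j * B i j with hD
  have hDpos : ∀ i j, i ≠ o → j ≠ o → 0 < D i j := fun i j hi hj => mul_self_pos.2 (hB0 i j hi hj)
  have hNb : ∀ i j, (N i j).natAbs < 2 ^ b := fun i j => by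
    rw [hN, Int.natAbs_mul]
    refine lt_of_le_of_lt (Nat.mul_le_mul ?_ (hY i j)) hYY
    refine (Int.natAbs_sum_le _ _).trans ((Finset.sum_le_card_nsmul _ _ Y fun u _ => hY i u).trans ?_)
    simp
  have hDb : ∀ i j, (D i j).natAbs < 2 ^ b := fun i j => by
    rw [hD, Int.natAbs_mul]
    refine lt_of_le_of_lt (Nat.mul_le_mul (hY i j) (hY i j)) (lt_of_le_of_lt ?_ hYY)
    exact Nat.mul_le_mul_right _ (Nat.le_mul_of_pos_left _ i.pos)
  refine Runs.seq 1 (n * n * (n * 4 + 25) + 3) (Runs.assign hb (by decide) (fun _ => ?_) ?_)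
  · have := Nat.one_lt_two_pow (n := b) (by omega)
    simpa [Expr.eval] using this
  refine Runs.forCells hb (n * 4 + 18)
    (fun m s => IsMaxRatio N D o m (s.reg 11) (s.reg 12)) hn (by decide) (by decide)
    (by simpa using hs) (fun m s x z hx h => ?_) ?_ ?_ (fun _ _ h => h) (le_refl _)
  · have h1 : 11 ≠ x := by rintro rfl; simp at hx
    have h2 : 12 ≠ x := by rintro rfl; simp at hx
    simpa [h1, h2] using h
  · simpa [Expr.eval, h11] using IsMaxRatio.zero N D o
  · intro i j s₁ ha h2 h3 h4 hI
    have hB₁ : Holds s₁ 1 B := hB.congr (ha.2 1 (by decide))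
    have h0 : s₁.reg 0 = n := by rw [ha.1 0 (by decide)]; simpa using hs
    refine Runs.seq (n * 4 + 5) 12
      ((Runs.rowSum hb hn' h0 h3 hB₁ (fun j => hY i j) hYb).mono le_rfl ?_)
    intro s₂ ha' h6
    have e1 : s₂.reg 1 = (o : ℕ) := by
      rw [ha'.1 1 (by decide), ha.1 1 (by decide)]; simpa using ho
    have e2 : s₂.reg 2 = ((i * n + j : ℕ) : ℤ) := by rw [ha'.1 2 (by decide), h2]
    have e3 : s₂.reg 3 = (i : ℕ) := by rw [ha'.1 3 (by decide), h3]
    have e4 : s₂.reg 4 = (j : ℕ) := by rw [ha'.1 4 (by decide), h4]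
    have e11 : s₂.reg 11 = s₁.reg 11 := ha'.1 11 (by decide)
    have e12 : s₂.reg 12 = s₁.reg 12 := ha'.1 12 (by decide)
    rw [← e11, ← e12] at hI
    have eB : s₂.mem 1 (i * n + j) = B i j := by rw [ha'.2 1 (by decide)]; exact hB₁ i j
    refine Runs.ite hb 10 (by decide) (fun hio => ?_) (fun hio => ?_) <;>
      rw [Expr.distinct_pos e3 e1, ne_eq, Fin.val_inj] at hio
    · refine Runs.ite hb 8 (by decide) (fun hjo => ?_) (fun hjo => ?_) <;>
        rw [Expr.distinct_pos e4 e1, ne_eq, Fin.val_inj] at hjo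
      · have v1 : (Expr.mul (.reg 6) (.load 1 (.reg 2))).eval s₂ = N i j := by
          simp only [Expr.eval, e2, h6, Int.toNat_natCast, eB, hN]
        refine Runs.seq 1 6 (Runs.assign hb (by decide) (fun _ => v1 ▸ hNb i j) ?_)
        rw [v1]
        have v2 : (Expr.mul (.load 1 (.reg 2)) (.load 1 (.reg 2))).eval (s₂.setReg 13 (N i j)) =
            D i j := by
          change s₂.mem 1 (s₂.reg 2).toNat * s₂.mem 1 (s₂.reg 2).toNat = B i j * B i j
          rw [e2, Int.toNat_natCast, eB]
        refine Runs.seq 1 4 (Runs.assign hb (by decide) (fun _ => v2 ▸ hDb i j) ?_)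
        rw [v2]
        have v3 : (Expr.sub (.mul (.reg 13) (.reg 12)) (.mul (.reg 11) (.reg 14))).eval
            ((s₂.setReg 13 (N i j)).setReg 14 (D i j)) =
            N i j * s₂.reg 12 - s₂.reg 11 * D i j := by
          simp [Expr.eval]
        refine Runs.ite hb 3 (by decide) (fun hlt => ?_) (fun hlt => ?_) <;>
          rw [v3, sub_pos] at hlt
        · refine Runs.seq 1 1 (Runs.assign hb (by decide) (fun hs => hs.1 13)
            (Runs.assign hb (by decide) (fun hs => hs.1 14) ?_))
          simpa [Expr.eval] using hI.replace hio hjo hDpos hlt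
        · refine Runs.skip ?_
          simpa using hI.succ fun _ _ => not_lt.1 hlt
      · exact Runs.skip (hI.succ fun _ h => absurd h hjo)
    · exact Runs.skip (hI.succ fun h => absurd h hio)

end RAM

open RAM

/-! ### The estimating program and its correctness -/

namespace Sandpile

variable {n : ℕ} (S : Sandpile (Fin n))

/-! ### The program -/

/-- The adjacency matrix, with multiplicities. -/
def adjacency : Matrix (Fin n) (Fin n) ℤ := fun i j => S.mult i j

/-- The number of edges that join ordinary vertices, as far as the entries of the adjacency matrix
before `m` are concerned. -/
def totalUpTo (m : ℕ) : ℕ :=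
  ∑ e : Fin n × Fin n, if (e.1 * n + e.2 : ℕ) < m then
    if e.1 ≠ S.sink ∧ e.2 ≠ S.sink then S.mult e.1 e.2 else 0 else 0

variable {S}

theorem totalUpTo_zero : S.totalUpTo 0 = 0 := by simp [totalUpTo]

theorem totalUpTo_succ (i j : Fin n) :
    S.totalUpTo (i * n + j + 1) = S.totalUpTo (i * n + j) +
      if i ≠ S.sink ∧ j ≠ S.sink then S.mult i j else 0 := by
  have h : (if i ≠ S.sink ∧ j ≠ S.sink then S.mult i j else 0) =
      ∑ e : Fin n × Fin n, if e = (i, j) then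
        if e.1 ≠ S.sink ∧ e.2 ≠ S.sink then S.mult e.1 e.2 else 0 else 0 := by
    rw [Finset.sum_ite_eq' Finset.univ (i, j) fun e : Fin n × Fin n =>
      if e.1 ≠ S.sink ∧ e.2 ≠ S.sink then S.mult e.1 e.2 else 0]
    simp
  rw [h, totalUpTo, totalUpTo, ← Finset.sum_add_distrib]
  refine Finset.sum_congr rfl fun e _ => ?_
  by_cases he : e = (i, j)
  · subst he; simp
  · have hne : (e.1 * n + e.2 : ℕ) ≠ i * n + j := fun h =>
      he (Prod.ext (cell_inj h).1 (cell_inj h).2)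
    have : (e.1 * n + e.2 : ℕ) < i * n + j + 1 ↔ (e.1 * n + e.2 : ℕ) < i * n + j := by omega
    simp only [this, he, if_false, add_zero]

theorem totalUpTo_eq : S.totalUpTo (n * n) = S.ordinaryTotal := by
  simp only [totalUpTo, cell_lt, if_true, Fintype.sum_prod_type, ordinaryTotal]
  rw [sum_ordinary (S := S)]
  simp only [ne_eq, not_true, false_and, if_false, Finset.sum_const_zero, zero_add]
  refine Finset.sum_congr rfl fun u _ => ?_
  rw [sum_ordinary (S := S)]
  simp only [not_true, and_false, if_false, zero_add]
  exact Finset.sum_congr rfl fun v _ => if_pos ⟨u.2, v.2⟩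

theorem totalUpTo_le {X : ℕ} (hX : ∀ i j, S.mult i j ≤ X) (m : ℕ) :
    S.totalUpTo m ≤ n * n * X := by
  refine (Finset.sum_le_card_nsmul _ _ X fun e _ => ?_).trans (by simp)
  have := hX e.1 e.2
  split_ifs <;> omega

theorem natAbs_laplacian_le {X : ℕ} (hX : ∀ i j, S.mult i j ≤ X) (hX1 : 1 ≤ X) (i j : Fin n) :
    (S.laplacian i j).natAbs ≤ n * X := by
  have hn : 1 ≤ n := i.pos
  have h1 : X ≤ n * X := Nat.le_mul_of_pos_left _ hn
  have h2 : S.degree i ≤ n * X :=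
    (Finset.sum_le_card_nsmul _ _ X fun u _ => hX i u).trans (by simp)
  have h3 := hX i j
  unfold laplacian
  split_ifs
  · simpa using hX1.trans h1
  · simp
  · simpa using h2
  · simpa using h3.trans h1

end Sandpile

namespace RAM

/-- Compute the Laplacian matrix in bank `1` and the number of edges that join ordinary vertices in
register `10`. -/
def Program.laplacian : Program :=
  .forCells (.seq (.rowSum 0) (.ite (.distinct 3 1)
    (.ite (.distinct 4 1)
      (.seq (.assign 10 (.add (.reg 10) (.load 0 (.reg 2))))
        (.ite (.distinct 3 4)
          (.store 1 (.reg 2) (.sub (.const 0) (.load 0 (.reg 2))))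
          (.store 1 (.reg 2) (.reg 6))))
      (.store 1 (.reg 2) (.const 0)))
    (.ite (.distinct 4 1)
      (.store 1 (.reg 2) (.const 0))
      (.store 1 (.reg 2) (.const 1)))))

theorem Runs.laplacian {b : ℕ} (hb : 1 ≤ b) {s : State} {n K X : ℕ} {S : Sandpile (Fin n)}
    (hX : ∀ i j, S.mult i j ≤ X) (hX1 : 1 ≤ X) (hn' : n < 2 ^ b) (hn : n * n < 2 ^ b)
    (hnX : n * X < 2 ^ b) (hnnX : n * n * X < 2 ^ b) (hs : s.reg 0 = n)
    (h1 : s.reg 1 = (S.sink : ℕ)) (h10 : s.reg 10 = 0) (hA : Holds s 0 S.adjacency)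
    (hK : n * n * (n * 4 + 21) + 3 ≤ K := by omega) :
    Runs b .laplacian s K fun s' =>
      Holds s' 1 S.laplacian ∧ s'.reg 10 = S.ordinaryTotal := by
  have hLb : ∀ i j, (S.laplacian i j).natAbs < 2 ^ b := fun i j =>
    (Sandpile.natAbs_laplacian_le hX hX1 i j).trans_lt hnX
  refine Runs.forCells hb (n * 4 + 14)
    (fun m s => HoldsUpTo m s 1 S.laplacian ∧ s.reg 10 = S.totalUpTo m) hn (by decide) (by decide)
    hs (fun m s x z hx h => ⟨h.1, ?_⟩) ⟨HoldsUpTo.zero _ _ _, ?_⟩ ?_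
    (fun s' _ h => ⟨h.1.holds, by rw [h.2, Sandpile.totalUpTo_eq]⟩) hK
  · have h1 : 10 ≠ x := by rintro rfl; simp at hx
    simpa [h1] using h.2
  · rw [h10, Sandpile.totalUpTo_zero]; rfl
  · intro i j s₁ ha h2 h3 h4 hI
    have hA₁ : Holds s₁ 0 S.adjacency := hA.congr (ha.2 0 (by decide))
    have h0 : s₁.reg 0 = n := by rw [ha.1 0 (by decide), hs]
    refine Runs.seq (n * 4 + 5) 8 ((Runs.rowSum hb hn' h0 h3 hA₁
      (fun j => by simpa [Sandpile.adjacency] using hX i j) hnX).mono le_rfl ?_)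
    intro s₂ ha' h6
    have e1 : s₂.reg 1 = (S.sink : ℕ) := by rw [ha'.1 1 (by decide), ha.1 1 (by decide), h1]
    have e2 : s₂.reg 2 = ((i * n + j : ℕ) : ℤ) := by rw [ha'.1 2 (by decide), h2]
    have e3 : s₂.reg 3 = (i : ℕ) := by rw [ha'.1 3 (by decide), h3]
    have e4 : s₂.reg 4 = (j : ℕ) := by rw [ha'.1 4 (by decide), h4]
    have e10 : s₂.reg 10 = S.totalUpTo (i * n + j) := by rw [ha'.1 10 (by decide), hI.2]
    have eA : s₂.mem 0 (i * n + j) = S.mult i j := by rw [ha'.2 0 (by decide)]; exact hA₁ i j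
    have e6 : s₂.reg 6 = S.degree i := by
      rw [h6, Sandpile.degree]; push_cast; rfl
    have hI₂ : HoldsUpTo (i * n + j) s₂ 1 S.laplacian := fun i' j' h => by
      rw [ha'.2 1 (by decide)]; exact hI.1 i' j' h
    have htot := Sandpile.totalUpTo_succ (S := S) i j
    refine Runs.ite hb 6 (by decide) (fun hi => ?_) (fun hi => ?_) <;>
      rw [Expr.distinct_pos e3 e1, ne_eq, Fin.val_inj] at hi
    · refine Runs.ite hb 5 (by decide) (fun hj => ?_) (fun hj => ?_) <;>
        rw [Expr.distinct_pos e4 e1, ne_eq, Fin.val_inj] at hj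
      · rw [if_pos ⟨hi, hj⟩] at htot
        have v1 : (Expr.add (.reg 10) (.load 0 (.reg 2))).eval s₂ =
            S.totalUpTo (i * n + j + 1) := by
          simp only [Expr.eval, e2, e10, Int.toNat_natCast, eA, htot]
          norm_cast
        refine Runs.seq 1 3 (Runs.assign hb (by decide) (fun _ => ?_) ?_)
        · rw [v1, Int.natAbs_natCast]
          exact (Sandpile.totalUpTo_le hX _).trans_lt hnnX
        rw [v1]
        refine Runs.ite hb 1 (by decide) (fun hij => ?_) (fun hij => ?_) <;>
          rw [Expr.distinct_pos (m := i) (k := j) (by simpa using e3) (by simpa using e4), ne_eq,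
            Fin.val_inj] at hij <;>
          refine Runs.storeCell hb (by simpa using e2) (by decide) ?_ (fun _ => hLb i j)
            ⟨(hI₂.setReg 10 _).setMem, by simp⟩
        · change 0 - s₂.mem 0 (s₂.reg 2).toNat = _
          rw [e2, Int.toNat_natCast, eA]
          simp [Sandpile.laplacian, hi, hj, hij]
        · rw [not_not] at hij
          subst hij
          simpa [Expr.eval, Sandpile.laplacian, hi] using e6
      · rw [if_neg fun h => hj h.2, add_zero] at htot
        refine Runs.storeCell hb e2 (by decide) ?_ (fun _ => hLb i j)
            ⟨hI₂.setMem, by rw [State.reg_setMem, e10, htot]⟩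
        rw [not_not] at hj
        simp [Expr.eval, Sandpile.laplacian, hj, hi]
    · rw [if_neg fun h => hi h.1, add_zero] at htot
      rw [not_not] at hi
      refine Runs.ite hb 1 (by decide) (fun hj => ?_) (fun hj => ?_) <;>
        rw [Expr.distinct_pos e4 e1, ne_eq, Fin.val_inj] at hj <;>
        refine Runs.storeCell hb e2 (by decide) ?_ (fun _ => hLb i j)
            ⟨hI₂.setMem, by rw [State.reg_setMem, e10, htot]⟩
      · simp [Expr.eval, Sandpile.laplacian, hi, Ne.symm hj]
      · rw [not_not] at hj
        simp [Expr.eval, Sandpile.laplacian, hi, hj]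

/-- The program that estimates the transience class. -/
def Program.transience : Program :=
  .seq .laplacian (.seq .adjugate (.seq .maximize
    (.ite (.sub (.reg 10) (.const 2))
      (.seq (.assign 0 (.reg 11)) (.assign 1 (.reg 12)))
      (.seq (.assign 0 (.const 0)) (.assign 1 (.const 1))))))

end RAM

namespace Sandpile

variable {n : ℕ} {S : Sandpile (Fin n)}

theorem det_mixRows_laplacian_ne_zero (k : ℕ) : (Matrix.mixRows k S.laplacian 1).det ≠ 0 := by
  refine det_ne_zero_of_rows (S := S) fun i => ?_
  unfold Matrix.mixRows
  split_ifs
  · exact Or.inl rfl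
  · right
    ext j
    simp [Matrix.one_apply, Pi.single_apply, eq_comm]

theorem adjugate_eq_green (v w : Fin n) :
    (S.laplacian.adjugate v w : ℝ) = S.laplacian.det * S.green v w := by
  rw [green_comm, green, mul_div_cancel₀]
  exact Int.cast_ne_zero.2 det_laplacian_ne_zero

/-- The adjugate is the determinant times the symmetric matrix of Green values. The squared
determinant cancels, and including the sink in row sums adds 0. -/
theorem isGreatest_of_isMaxRatio (hS : S.ConnectedOffSink) (w₀ : S.Ordinary) {p q : ℕ}
    (h : RAM.IsMaxRatio
      (fun i j => (∑ u, S.laplacian.adjugate i u) * S.laplacian.adjugate i j)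
      (fun i j => S.laplacian.adjugate i j * S.laplacian.adjugate i j) S.sink (n * n) p q) :
    IsGreatest S.potentialEstimates ((p : ℝ) / q) := by
  have hd : (0 : ℝ) < (S.laplacian.det : ℝ) * S.laplacian.det :=
    mul_self_pos.2 (Int.cast_ne_zero.2 det_laplacian_ne_zero)
  have hN : ∀ i j : S.Ordinary,
      (((∑ u, S.laplacian.adjugate i u) * S.laplacian.adjugate i j : ℤ) : ℝ) =
        S.laplacian.det * S.laplacian.det * ((∑ u : S.Ordinary, S.green i u) * S.green i j) := by
    intro i j
    rw [Int.cast_mul, Int.cast_sum, adjugate_eq_green]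
    simp only [adjugate_eq_green]
    rw [← Finset.mul_sum, sum_ordinary (S := S), (isGreen_green (S := S) i.2).sink]
    ring
  have hD : ∀ i j : S.Ordinary,
      ((S.laplacian.adjugate i j * S.laplacian.adjugate i j : ℤ) : ℝ) =
        S.laplacian.det * S.laplacian.det * (S.green i j * S.green i j) := by
    intro i j
    rw [Int.cast_mul, adjugate_eq_green]
    ring
  have hsum : ∀ i : S.Ordinary, 0 < ∑ u : S.Ordinary, S.green i u := fun i =>
    Finset.sum_pos (fun u _ => green_pos hS i u) ⟨i, Finset.mem_univ i⟩
  have hq : (0 : ℝ) < q := by exact_mod_cast h.den_pos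
  have hle : ∀ i j : S.Ordinary, (∑ u : S.Ordinary, S.green i u) * q ≤ p * S.green i j := by
    intro i j
    have h1 := h.le i j i.2 j.2 (RAM.cell_lt _ _)
    have h2 : (((∑ u, S.laplacian.adjugate i u) * S.laplacian.adjugate i j : ℤ) : ℝ) * q ≤
        p * ((S.laplacian.adjugate i j * S.laplacian.adjugate i j : ℤ) : ℝ) := by
      exact_mod_cast h1
    rw [hN, hD] at h2
    have hg := green_pos hS i j
    refine le_of_mul_le_mul_left ?_ (mul_pos hd hg)
    linarith
  rw [potentialEstimates_eq hS]
  constructor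
  · rcases h.attained with h0 | ⟨i, j, hi, hj, hp, hq'⟩
    · have h1 := hle w₀ w₀
      have h2 := mul_pos (hsum w₀) hq
      have h3 : (p : ℝ) = 0 := by exact_mod_cast h0
      rw [h3, zero_mul] at h1
      linarith
    · refine ⟨⟨j, hj⟩, ⟨i, hi⟩, ?_⟩
      have hg := green_pos hS ⟨i, hi⟩ ⟨j, hj⟩
      have hp' : (p : ℝ) = (((∑ u, S.laplacian.adjugate i u) * S.laplacian.adjugate i j : ℤ) : ℝ) := by
        exact_mod_cast hp
      have hq'' : (q : ℝ) = ((S.laplacian.adjugate i j * S.laplacian.adjugate i j : ℤ) : ℝ) := by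
        exact_mod_cast hq'
      rw [hp', hq'', hN ⟨i, hi⟩ ⟨j, hj⟩, hD ⟨i, hi⟩ ⟨j, hj⟩, mul_div_mul_left _ _ hd.ne',
        mul_div_mul_right _ _ hg.ne']
  · rintro r ⟨v, w, rfl⟩
    rw [div_le_div_iff₀ (green_pos hS w v) hq]
    exact hle w v

theorem le_inputSize : n ≤ S.inputSize := by
  have h : ∑ _i : Fin n, ∑ _j : Fin n, 1 ≤ ∑ i, ∑ j, RAM.wordCost (S.mult i j) :=
    Finset.sum_le_sum fun i _ => Finset.sum_le_sum fun j _ => Nat.le_add_right 1 _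
  simp only [Finset.sum_const, Finset.card_univ, Fintype.card_fin, smul_eq_mul, mul_one] at h
  have h1 : n ≤ n * n := Nat.le_mul_self n
  unfold inputSize
  omega

theorem mult_lt_inputSize (i j : Fin n) : S.mult i j < 2 ^ S.inputSize := by
  have h1 : RAM.wordCost (S.mult i j) ≤ ∑ j, RAM.wordCost (S.mult i j) :=
    Finset.single_le_sum (f := fun j => RAM.wordCost (S.mult i j)) (fun _ _ => Nat.zero_le _)
      (Finset.mem_univ j)
  have h2 : ∑ j, RAM.wordCost (S.mult i j) ≤ ∑ i, ∑ j, RAM.wordCost (S.mult i j) :=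
    Finset.single_le_sum (f := fun i => ∑ j, RAM.wordCost (S.mult i j))
      (fun _ _ => Nat.zero_le _) (Finset.mem_univ i)
  have h3 : (S.mult i j).size ≤ S.inputSize := by
    have : RAM.wordCost (S.mult i j) = 1 + (S.mult i j).size := rfl
    unfold inputSize
    omega
  exact (Nat.lt_size_self _).trans_le (Nat.pow_le_pow_right (by norm_num) h3)

/-- A bound for the lengths of the numbers that occur in the computation. -/
def bitBound (I : ℕ) : ℕ := 6 * I ^ 2 + 7 * I + 1

theorem bounded_input : RAM.Bounded (bitBound S.inputSize) S.input := by
  have hn := le_inputSize (S := S)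
  have hI : 2 ^ S.inputSize ≤ 2 ^ bitBound S.inputSize :=
    Nat.pow_le_pow_right (by norm_num) (by unfold bitBound; omega)
  have hlt : S.inputSize < 2 ^ S.inputSize := Nat.lt_two_pow_self
  refine ⟨fun x => ?_, fun a k => ?_⟩
  · simp only [input]
    have := S.sink.2
    split_ifs
    · rw [Int.natAbs_natCast]; omega
    · rw [Int.natAbs_natCast]; omega
    · simp
  · simp only [input]
    split_ifs
    · rw [Int.natAbs_natCast]
      exact (mult_lt_inputSize _ _).trans_le hI
    · simp

theorem holds_input : RAM.Holds S.input 0 S.adjacency := by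
  intro i j
  have hlt := RAM.cell_lt i j
  simp only [input, adjacency, hlt, true_and, dif_pos]
  have hn : 0 < n := i.pos
  have h1 : Fin.divNat ⟨(i * n + j : ℕ), hlt⟩ = i := by
    ext
    simp [Fin.divNat, mul_comm _ n, Nat.mul_add_div hn, Nat.div_eq_of_lt]
  have h2 : Fin.modNat ⟨(i * n + j : ℕ), hlt⟩ = j := by
    ext
    simp [Fin.modNat, mul_comm _ n, Nat.mod_eq_of_lt]
  rw [h1, h2]

theorem runs_transience (hS : S.ConnectedOffSink) :
    RAM.Runs (bitBound S.inputSize) .transience S.input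
      (n * n * (n * 4 + 21) + n * (n * n * 18 + 14) + n * n * (n * 4 + 25) + 20) fun s =>
      ∃ p q : ℤ, RAM.IsMaxRatio
          (fun i j => (∑ u, S.laplacian.adjugate i u) * S.laplacian.adjugate i j)
          (fun i j => S.laplacian.adjugate i j * S.laplacian.adjugate i j) S.sink (n * n) p q ∧
        if 2 < S.ordinaryTotal then s.reg 0 = p ∧ s.reg 1 = q
        else s.reg 0 = 0 ∧ s.reg 1 = 1 := by
  set I := S.inputSize with hI
  set b := bitBound I with hbdef
  have hb : 1 ≤ b := by rw [hbdef, bitBound]; omega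
  have hn := le_inputSize (S := S)
  rw [← hI] at hn
  have h2n : n ≤ 2 ^ I := hn.trans Nat.lt_two_pow_self.le
  have hpow : ∀ k, k < b → 2 ^ k < 2 ^ b := fun k hk => Nat.pow_lt_pow_right (by norm_num) hk
  have hmul : ∀ {x y k l : ℕ}, x ≤ 2 ^ k → y ≤ 2 ^ l → x * y ≤ 2 ^ (k + l) := fun h h' => by
    rw [pow_add]; exact Nat.mul_le_mul h h'
  have hnpow : ∀ {x k : ℕ}, 1 ≤ 2 ^ k → x ≤ 2 ^ k → x ^ n ≤ 2 ^ (k * I) := fun {x k} h1 h => by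
    rw [pow_mul]
    exact (Nat.pow_le_pow_left h n).trans (Nat.pow_le_pow_right h1 hn)
  have hX : ∀ i j, S.mult i j ≤ 2 ^ I := fun i j => (mult_lt_inputSize i j).le
  have hX1 : 1 ≤ 2 ^ I := Nat.one_le_two_pow
  have hL : ∀ i j, (S.laplacian i j).natAbs ≤ 2 ^ (I + I) := fun i j =>
    (natAbs_laplacian_le hX hX1 i j).trans (hmul h2n le_rfl)
  set Y := n * (2 ^ (I + I) * (n ^ n * (2 ^ (I + I)) ^ n)) with hY
  have hYle : Y ≤ 2 ^ (I + (I + I + (I * I + (I + I) * I))) :=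
    hmul h2n (hmul le_rfl (hmul (hnpow hX1 h2n) (hnpow Nat.one_le_two_pow le_rfl)))
  have hPY : ∀ k i j, (Matrix.partialAdjugate S.laplacian k i j).natAbs ≤ Y := fun k i j =>
    Matrix.natAbs_partialAdjugate_le Nat.one_le_two_pow hL k i j
  have hYb : Y < 2 ^ b := hYle.trans_lt (hpow _ (by rw [hbdef, bitBound]; ring_nf; nlinarith))
  have hnYb : n * Y < 2 ^ b :=
    (hmul h2n hYle).trans_lt (hpow _ (by rw [hbdef, bitBound]; ring_nf; nlinarith))
  -- The largest bound: `Y` has exponent `3I + 3I²`, so this has `I + 2(3I + 3I²) = 6I² + 7I`, one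
  -- less than `bitBound I`.
  have hnYYb : n * Y * Y < 2 ^ b :=
    (hmul (hmul h2n hYle) hYle).trans_lt (hpow _ (by rw [hbdef, bitBound]; ring_nf; nlinarith))
  have hn1 : n < 2 ^ b := h2n.trans_lt (hpow _ (by rw [hbdef, bitBound]; omega))
  have hn2 : n * n < 2 ^ b :=
    (hmul h2n h2n).trans_lt (hpow _ (by rw [hbdef, bitBound]; omega))
  have hnX : n * 2 ^ I < 2 ^ b :=
    (hmul h2n le_rfl).trans_lt (hpow _ (by rw [hbdef, bitBound]; omega))
  have hnnX : n * n * 2 ^ I < 2 ^ b :=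
    (hmul (hmul h2n h2n) le_rfl).trans_lt (hpow _ (by rw [hbdef, bitBound]; omega))
  have i0 : S.input.reg 0 = n := rfl
  have i1 : S.input.reg 1 = (S.sink : ℕ) := rfl
  have hadj0 : ∀ i j, i ≠ S.sink → j ≠ S.sink → S.laplacian.adjugate i j ≠ 0 := by
    intro i j hi hj h
    have h1 := adjugate_eq_green (S := S) i j
    rw [h, Int.cast_zero, eq_comm, mul_eq_zero] at h1
    exact h1.elim (Int.cast_ne_zero.2 det_laplacian_ne_zero) (green_pos hS ⟨i, hi⟩ ⟨j, hj⟩).ne'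
  refine Runs.seq (n * n * (n * 4 + 21) + 3)
    (n * (n * n * 18 + 14) + n * n * (n * 4 + 25) + 16)
    ((Runs.laplacian hb hX hX1 hn1 hn2 hnX hnnX i0 i1 rfl holds_input).mono le_rfl ?_)
  rintro s₁ a₁ ⟨hL₁, ht₁⟩
  have z0 : s₁.reg 0 = n := a₁.1 0 (by decide)
  refine Runs.seq (n * (n * n * 18 + 14) + 5) (n * n * (n * 4 + 25) + 10)
    ((Runs.adjugate hb hn1 hn2 z0 hL₁ det_mixRows_laplacian_ne_zero
      fun k i j => (hPY k i j).trans_lt hYb).mono le_rfl ?_)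
  intro s₂ a₂ hA₂
  have y0 : s₂.reg 0 = n := by rw [a₂.1 0 (by decide), z0]
  have y1 : s₂.reg 1 = (S.sink : ℕ) := by rw [a₂.1 1 (by decide), a₁.1 1 (by decide), i1]
  -- The running maximum starts at 0 because the input state leaves this register 0.
  have y11 : s₂.reg 11 = 0 := by rw [a₂.1 11 (by decide), a₁.1 11 (by decide)]; rfl
  refine Runs.seq (n * n * (n * 4 + 25) + 5) 4
    ((Runs.maximize hb hn1 hn2 y0 y1 y11 hA₂ hadj0 (Y := Y)
      (fun i j => by rw [← Matrix.partialAdjugate_self]; exact hPY n i j) hnYb hnYYb).mono le_rfl ?_)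
  intro s₃ a₃ hmax
  have x10 : s₃.reg 10 = S.ordinaryTotal := by
    rw [a₃.1 10 (by decide), a₂.1 10 (by decide), ht₁]
  have htest : 0 < (RAM.Expr.sub (.reg 10) (.const 2)).eval s₃ ↔ 2 < S.ordinaryTotal := by
    simp only [Expr.eval, x10, sub_pos]
    exact_mod_cast Iff.rfl
  refine Runs.ite hb 3 (by decide) (fun h => ?_) (fun h => ?_) <;> rw [htest] at h
  · refine Runs.seq 1 1 (Runs.assign hb (by decide) (fun hB => hB.1 11)
      (Runs.assign hb (by decide) (fun hB => hB.1 12) ⟨_, _, hmax, ?_⟩))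
    simp [Expr.eval, h]
  · refine Runs.seq 1 1 (Runs.assign hb (by decide) (fun hB => by simp [Expr.eval])
      (Runs.assign hb (by decide) (fun hB => ?_) ⟨_, _, hmax, ?_⟩))
    · have := Nat.one_lt_two_pow (n := b) (by omega)
      simpa [Expr.eval] using this
    · simp [Expr.eval, h]

end Sandpile

theorem mainTheorem4 :
    ∃ (P : RAM.Program) (T : Polynomial ℕ), ∀ Δ : ℕ, ∃ C : ℕ, 0 < C ∧
      ∀ (n : ℕ) (S : Sandpile (Fin n)),
        S.ConnectedOffSink → (∀ v : S.Ordinary, S.degree v ≤ Δ) →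
        ∃ (s : RAM.State) (t : ℕ) (p q : ℕ),
          RAM.Exec P S.input s t ∧ t ≤ T.eval S.inputSize ∧
          s.reg 0 = p ∧ s.reg 1 = q ∧ 0 < q ∧
          (q : ℕ∞) * S.tcl ≤ C * p ∧ (p : ℕ∞) ≤ C * (q * S.tcl) ∧
          (0 < S.tcl → IsGreatest S.potentialEstimates ((p : ℝ) / q)) := by
  -- The cubic factor dominates the number of steps and the other one is `stepCost (bitBound I)`.
  refine ⟨.transience, 60 * (.X + 1) ^ 3 * (1 + 60 * (1 + (6 * .X ^ 2 + 7 * .X + 1) * 30)),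
    fun Δ => ⟨2 * (1 + Δ ^ 2), by positivity, fun n S hS hΔ => ?_⟩⟩
  obtain ⟨s, t, hexec, ht, -, p, q, hmax, hout⟩ :=
    Sandpile.runs_transience hS Sandpile.bounded_input
  have hT : t ≤ Polynomial.eval S.inputSize
      (60 * (.X + 1) ^ 3 * (1 + 60 * (1 + (6 * .X ^ 2 + 7 * .X + 1) * 30))) := by
    have he : Polynomial.eval S.inputSize
        (60 * (.X + 1) ^ 3 * (1 + 60 * (1 + (6 * .X ^ 2 + 7 * .X + 1) * 30)) : Polynomial ℕ) =
        60 * (S.inputSize + 1) ^ 3 * RAM.stepCost (Sandpile.bitBound S.inputSize) := by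
      simp [RAM.stepCost, Sandpile.bitBound]
    rw [he]
    refine ht.trans (Nat.mul_le_mul_right _ ?_)
    have hn : n ≤ S.inputSize := Sandpile.le_inputSize
    calc _ ≤ 60 * (n + 1) ^ 3 := by ring_nf; nlinarith [Nat.zero_le n]
      _ ≤ _ := by gcongr
  by_cases htot : 2 < S.ordinaryTotal
  · rw [if_pos htot] at hout
    obtain ⟨p, rfl⟩ := Int.eq_ofNat_of_zero_le hmax.num_nonneg
    obtain ⟨q, rfl⟩ := Int.eq_ofNat_of_zero_le hmax.den_pos.le
    have hq : 0 < q := by exact_mod_cast hmax.den_pos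
    obtain ⟨w⟩ : Nonempty S.Ordinary := by
      by_contra h
      rw [not_nonempty_iff] at h
      simp [Sandpile.ordinaryTotal] at htot
    have hA := Sandpile.isGreatest_of_isMaxRatio hS w hmax
    obtain ⟨h1, h2⟩ := Sandpile.tcl_bounds hS hΔ htot hq hA
    exact ⟨s, t, p, q, hexec, hT, hout.1, hout.2, hq, h1, h2, fun _ => hA⟩
  -- With at most one ordinary edge the output is 0/1, matching a transience class of 0.
  · rw [if_neg htot] at hout
    have h0 := Sandpile.tcl_eq_zero hS (not_lt.1 htot)
    exact ⟨s, t, 0, 1, hexec, hT, by simpa using hout.1, by simpa using hout.2, one_pos,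
      by simp [h0], by simp, by simp [h0]⟩
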